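/- For integers $n\ge 0$ let $H_n(2)=\sum_{j=1}^{n}\frac{1}{j^2}$ (so $H_0(2)=0$). For rational numbers $x,y$ and a prime $p$, write $x\equiv y\pmod p$ if $x-y=pc$ for some rational number $c$ whose reduced denominator is not divisible by $p$. Then for every prime $p>5$, $$ \sum_{k=1}^{p-1}\frac{1}{k^4\binom{2k}{k}}-3\sum_{k=1}^{p-1}\frac{H_{k-1}(2)}{k^2\binom{2k}{k}}\equiv 0\pmod{p}. $$ -/

import Mathlib

/-- The generalized harmonic number `H_n(a) = ∑_{1 ≤ k ≤ n} 1 / k ^ a` as a rational number;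
it is `0` for `n = 0`. -/
def harmonicSum (n a : ℕ) : ℚ :=
  ∑ k ∈ Finset.Icc 1 n, 1 / (k : ℚ) ^ a

/-- Congruence of rational numbers modulo a natural number `m`: `x ≡ y (mod m)` means that
`x - y = m * c` for some rational number `c` whose reduced denominator is coprime to `m`. -/
def RatModEq (m : ℕ) (x y : ℚ) : Prop :=
  ∃ c : ℚ, Nat.Coprime c.den m ∧ x - y = (m : ℚ) * c

/-! The left-hand side `T` is the first-order coefficient in `t` of the Bailey–Borwein–Bradley sum
`∑ bbbTerm t`, whose constant coefficient is `∑ 1/(k² C(2k,k))`. At `t = p²/4` the error terms have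
valuation at least 3, the inverse binomials costing only one factor `p` (`padicGe_bbbTerm_sub`). So
it is enough that the full sum and its constant coefficient agree modulo `p³`: then `p² T / 4 ≡ 0`
modulo `p³`, and `T ≡ 0` modulo `p`. Both turn out to be `-H_{p-1}(2)/6`.

For the full sum, a Wilf–Zeilberger pair gives an exact value when `4t = p²`, because the numerator
factor `p² - 4t` makes the series terminate (`sum_bbbTerm`). The term `k = p` is known in closed
form, and removing it leaves `(2/(3p²)) (1 - 1/Q)` with `Q = ∏ (1 - t/j²)`, which is then expanded
(`padicGe_sum_bbbTerm`).

For the constant coefficient, `altRecipSum_eq_centralSum` links it to `∑ (-1)^(k-1)/k²` and a sum of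
factorial quotients. Expanding the latter in `p` leaves `H_{p-1}(1)` and `∑ H_{n-1}(1)/n²`.
Reflection `k ↦ p - k`, the binomial formula for `H_p`, and the doubling of the range `1..p-1`
express everything through `H_{p-1}(2)` (`padicGe_centralSum`). -/

/-- `PadicGe p n x` says that the `p`-adic valuation of `x` is at least `n`. -/
def PadicGe (p : ℕ) (n : ℤ) (x : ℚ) : Prop := padicNorm p x ≤ (p : ℚ) ^ (-n)

/-- `PadicUnit p x` says that `x` is a unit of the ring of `p`-integral rationals. -/
def PadicUnit (p : ℕ) (x : ℚ) : Prop := padicNorm p x = 1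

/-! ### Calculus of `p`-adic valuation bounds on rationals. -/

section Valuation

set_option linter.unusedSectionVars false

variable {p : ℕ} [hp : Fact p.Prime] {m n : ℤ} {x y : ℚ}

theorem PadicGe.zero : PadicGe p n 0 := by
  unfold PadicGe
  rw [padicNorm.zero]
  positivity

theorem PadicGe.add (hx : PadicGe p n x) (hy : PadicGe p n y) : PadicGe p n (x + y) :=
  padicNorm.nonarchimedean.trans (max_le hx hy)

theorem PadicGe.neg (hx : PadicGe p n x) : PadicGe p n (-x) := by
  unfold PadicGe
  rwa [padicNorm.neg]

theorem PadicGe.sub (hx : PadicGe p n x) (hy : PadicGe p n y) : PadicGe p n (x - y) := by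
  rw [sub_eq_add_neg]
  exact hx.add hy.neg

theorem PadicGe.mul (hx : PadicGe p m x) (hy : PadicGe p n y) : PadicGe p (m + n) (x * y) := by
  have h0 : (p : ℚ) ≠ 0 := by exact_mod_cast hp.out.ne_zero
  unfold PadicGe at *
  rw [padicNorm.mul, neg_add, zpow_add₀ h0]
  exact mul_le_mul hx hy (padicNorm.nonneg _) (by positivity)

theorem PadicGe.mul_of_eq {k : ℤ} (hx : PadicGe p m x) (hy : PadicGe p n y) (h : m + n = k) :
    PadicGe p k (x * y) := h ▸ hx.mul hy

theorem PadicGe.mono (hx : PadicGe p m x) (h : n ≤ m) : PadicGe p n x := by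
  have h1 : (1 : ℚ) ≤ p := by exact_mod_cast hp.out.one_lt.le
  exact hx.trans (zpow_le_zpow_right₀ h1 (by omega))

theorem PadicGe.sum {ι : Type*} {s : Finset ι} {f : ι → ℚ} (h : ∀ i ∈ s, PadicGe p n (f i)) :
    PadicGe p n (∑ i ∈ s, f i) := by
  classical
  induction s using Finset.induction_on with
  | empty => simpa using PadicGe.zero
  | insert a s ha ih =>
    rw [Finset.sum_insert ha]
    exact (h a (by simp)).add (ih fun i hi => h i (by simp [hi]))

theorem padicGe_one_self : PadicGe p 1 (p : ℚ) := by
  unfold PadicGe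
  rw [padicNorm.padicNorm_p hp.out.one_lt, zpow_neg_one]

theorem padicGe_pow_self (k : ℕ) : PadicGe p k ((p : ℚ) ^ k) := by
  induction k with
  | zero => simp [PadicGe]
  | succ k ih =>
    rw [pow_succ]
    exact ih.mul_of_eq padicGe_one_self (by push_cast; ring)

theorem padicGe_inv_self : PadicGe p (-1) (1 / (p : ℚ)) := by
  unfold PadicGe
  rw [padicNorm.div, padicNorm.padicNorm_p hp.out.one_lt]
  simp

theorem PadicUnit.ge (hx : PadicUnit p x) : PadicGe p 0 x := by
  unfold PadicUnit at hx
  simp [PadicGe, hx]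

theorem PadicUnit.ne_zero (hx : PadicUnit p x) : x ≠ 0 := by
  rintro rfl
  simp [PadicUnit] at hx

theorem PadicUnit.mul (hx : PadicUnit p x) (hy : PadicUnit p y) : PadicUnit p (x * y) := by
  unfold PadicUnit at *
  rw [padicNorm.mul, hx, hy, one_mul]

theorem PadicUnit.div (hx : PadicUnit p x) (hy : PadicUnit p y) : PadicUnit p (x / y) := by
  unfold PadicUnit at *
  rw [padicNorm.div, hx, hy, one_div_one]

theorem PadicUnit.one : PadicUnit p 1 := by simp [PadicUnit]

theorem PadicUnit.neg (hx : PadicUnit p x) : PadicUnit p (-x) := by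
  unfold PadicUnit at *
  rwa [padicNorm.neg]

theorem PadicUnit.inv (hx : PadicUnit p x) : PadicUnit p (1 / x) := PadicUnit.one.div hx

theorem PadicUnit.pow (hx : PadicUnit p x) (k : ℕ) : PadicUnit p (x ^ k) := by
  induction k with
  | zero => simpa using PadicUnit.one
  | succ k ih => rw [pow_succ]; exact ih.mul hx

theorem PadicUnit.add_of_ge (hx : PadicUnit p x) (hy : PadicGe p 1 y) : PadicUnit p (x + y) := by
  have h1 : (1 : ℚ) < p := by exact_mod_cast hp.out.one_lt
  have hy1 : padicNorm p y < 1 := hy.trans_lt (zpow_lt_one_of_neg₀ h1 (by norm_num))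
  unfold PadicUnit at *
  rw [padicNorm.add_eq_max_of_ne (by rw [hx]; exact hy1.ne'), hx, max_eq_left hy1.le]

theorem PadicUnit.sub_of_ge (hx : PadicUnit p x) (hy : PadicGe p 1 y) : PadicUnit p (x - y) := by
  rw [sub_eq_add_neg]
  exact hx.add_of_ge hy.neg

theorem padicUnit_natCast {k : ℕ} (h : ¬ p ∣ k) : PadicUnit p (k : ℚ) :=
  (padicNorm.nat_eq_one_iff k).2 h

theorem padicUnit_of_pos_of_lt {k : ℕ} (h0 : k ≠ 0) (h : k < p) : PadicUnit p (k : ℚ) :=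
  padicUnit_natCast fun hd => absurd (Nat.le_of_dvd (by omega) hd) (by omega)

theorem padicUnit_succ {k : ℕ} (h : k + 1 < p) : PadicUnit p ((k : ℚ) + 1) := by
  exact_mod_cast padicUnit_of_pos_of_lt (k.succ_ne_zero) h

theorem PadicGe.of_mul_unit (hx : PadicUnit p x) (h : PadicGe p n (x * y)) : PadicGe p n y := by
  unfold PadicUnit PadicGe at *
  rwa [padicNorm.mul, hx, one_mul] at h

theorem padicGe_intCast (k : ℤ) : PadicGe p 0 (k : ℚ) := by
  simpa [PadicGe] using padicNorm.of_int k

theorem padicGe_natCast (k : ℕ) : PadicGe p 0 (k : ℚ) := by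
  exact_mod_cast padicGe_intCast (p := p) (k : ℤ)

theorem PadicGe.one : PadicGe p 0 (1 : ℚ) := PadicUnit.one.ge

theorem PadicGe.pow (hx : PadicGe p 0 x) (k : ℕ) : PadicGe p 0 (x ^ k) := by
  induction k with
  | zero => simpa using PadicGe.one
  | succ k ih => rw [pow_succ]; exact ih.mul_of_eq hx (by norm_num)

theorem PadicGe.unit_mul (hx : PadicUnit p x) (hy : PadicGe p n y) : PadicGe p n (x * y) :=
  hx.ge.mul_of_eq hy (by ring)

theorem PadicGe.int_mul (hx : PadicGe p 0 x) (hy : PadicGe p n y) : PadicGe p n (x * y) :=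
  hx.mul_of_eq hy (by ring)

theorem padicGe_inv_pow_self (k : ℕ) : PadicGe p (-k) (1 / (p : ℚ) ^ k) := by
  induction k with
  | zero => simpa using PadicGe.one
  | succ k ih =>
    rw [pow_succ, ← one_div_mul_one_div]
    exact ih.mul_of_eq padicGe_inv_self (by push_cast; ring)

/-- Division by `p ^ k` lowers the valuation by `k`. -/
theorem PadicGe.of_pow_mul (k : ℕ) (h : PadicGe p n ((p : ℚ) ^ k * x)) : PadicGe p (n - k) x := by
  have h0 : (p : ℚ) ≠ 0 := by exact_mod_cast hp.out.ne_zero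
  have h1 := (padicGe_inv_pow_self k).mul_of_eq h (k := n - k) (by ring)
  rwa [← mul_assoc, one_div_mul_cancel (pow_ne_zero _ h0), one_mul] at h1

/-- If `p` divided the denominator of `c = x/p`, it would miss the numerator, so `c * c.den = c.num`
would have norm 1 although `c` has norm at most 1 and `c.den` less than 1. -/
theorem ratModEq_zero_of_padicGe (h : PadicGe p 1 x) : RatModEq p x 0 := by
  have h0 : (p : ℚ) ≠ 0 := by exact_mod_cast hp.out.ne_zero
  refine ⟨x / p, ?_, by field_simp; ring⟩
  have hc : padicNorm p (x / p) ≤ 1 := by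
    have := h.mul_of_eq (k := 0) padicGe_inv_self (by norm_num)
    rw [mul_one_div] at this
    simpa [PadicGe] using this
  rw [Nat.coprime_comm, hp.out.coprime_iff_not_dvd]
  intro hd
  set c := x / (p : ℚ)
  have hn : ¬ (p : ℤ) ∣ c.num := fun hn => by
    have := Nat.dvd_gcd (Int.natCast_dvd.1 hn) hd
    rw [c.reduced.gcd_eq_one] at this
    exact hp.out.one_lt.ne' (Nat.dvd_one.1 this)
  have h1 := (padicNorm.int_eq_one_iff (p := p) c.num).2 hn
  have h2 := (padicNorm.nat_lt_one_iff (p := p) c.den).2 hd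
  have h3 : (c.den : ℚ) ≠ 0 := by exact_mod_cast c.den_ne_zero
  have h4 : c * c.den = c.num := Rat.mul_den_eq_num c
  have h5 := padicNorm.mul (p := p) c c.den
  rw [h4, h1] at h5
  nlinarith [padicNorm.nonneg (p := p) (c.den : ℚ)]

end Valuation

/-! ### Harmonic sums and their reduction to `ZMod p`. -/

/-- The power sum `∑_{1 ≤ k ≤ n} 1 / k ^ s` in a field. -/
def recipSum (K : Type*) [Field K] (n s : ℕ) : K := ∑ k ∈ Finset.range n, 1 / ((k : K) + 1) ^ s

/-- The elementary symmetric sum `∑_{1 ≤ i < j ≤ n} 1 / (i j)` in a field. -/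
def recipPairSum (K : Type*) [Field K] (n : ℕ) : K :=
  ∑ k ∈ Finset.range n, 1 / ((k : K) + 1) * recipSum K k 1

theorem recipSum_succ (K : Type*) [Field K] (n s : ℕ) :
    recipSum K (n + 1) s = recipSum K n s + 1 / ((n : K) + 1) ^ s := by
  rw [recipSum, Finset.sum_range_succ]; rfl

theorem recipSum_zero (K : Type*) [Field K] (s : ℕ) : recipSum K 0 s = 0 := by simp [recipSum]

theorem recipPairSum_succ (K : Type*) [Field K] (n : ℕ) :
    recipPairSum K (n + 1) = recipPairSum K n + 1 / ((n : K) + 1) * recipSum K n 1 := by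
  rw [recipPairSum, Finset.sum_range_succ]; rfl

section Reduction

variable {p : ℕ} [hp : Fact p.Prime]

/-- `ReducesTo p x z` says that the rational `x` is `p`-integral with residue `z`. -/
def ReducesTo (p : ℕ) [Fact p.Prime] (x : ℚ) (z : ZMod p) : Prop :=
  ∃ a b : ℤ, (b : ZMod p) ≠ 0 ∧ x = a / b ∧ z = a / b

theorem intCast_ne_zero_of_zmod {b : ℤ} (h : (b : ZMod p) ≠ 0) : (b : ℚ) ≠ 0 := by
  rintro h0
  exact h (by rw [Int.cast_eq_zero.1 h0, Int.cast_zero])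

theorem ReducesTo.add {x y : ℚ} {z w : ZMod p} (h : ReducesTo p x z) (h' : ReducesTo p y w) :
    ReducesTo p (x + y) (z + w) := by
  obtain ⟨a, b, hb, rfl, rfl⟩ := h
  obtain ⟨c, d, hd, rfl, rfl⟩ := h'
  refine ⟨a * d + b * c, b * d, by push_cast; exact mul_ne_zero hb hd, ?_, ?_⟩
  · push_cast
    rw [div_add_div _ _ (intCast_ne_zero_of_zmod hb) (intCast_ne_zero_of_zmod hd)]
  · push_cast
    rw [div_add_div _ _ hb hd]

theorem ReducesTo.mul {x y : ℚ} {z w : ZMod p} (h : ReducesTo p x z) (h' : ReducesTo p y w) :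
    ReducesTo p (x * y) (z * w) := by
  obtain ⟨a, b, hb, rfl, rfl⟩ := h
  obtain ⟨c, d, hd, rfl, rfl⟩ := h'
  refine ⟨a * c, b * d, by push_cast; exact mul_ne_zero hb hd, ?_, ?_⟩
  · push_cast
    rw [div_mul_div_comm]
  · push_cast
    rw [div_mul_div_comm]

theorem ReducesTo.intCast (a : ℤ) : ReducesTo p (a : ℚ) (a : ZMod p) :=
  ⟨a, 1, by simp, by simp, by simp⟩

theorem ReducesTo.zero : ReducesTo p 0 0 := by simpa using ReducesTo.intCast (p := p) 0

theorem ReducesTo.one : ReducesTo p 1 1 := by simpa using ReducesTo.intCast (p := p) 1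

theorem ReducesTo.pow {x : ℚ} {z : ZMod p} (h : ReducesTo p x z) (k : ℕ) :
    ReducesTo p (x ^ k) (z ^ k) := by
  induction k with
  | zero => simpa using ReducesTo.one
  | succ k ih => rw [pow_succ, pow_succ]; exact ih.mul h

theorem ReducesTo.sum {ι : Type*} {s : Finset ι} {f : ι → ℚ} {g : ι → ZMod p}
    (h : ∀ i ∈ s, ReducesTo p (f i) (g i)) : ReducesTo p (∑ i ∈ s, f i) (∑ i ∈ s, g i) := by
  classical
  induction s using Finset.induction_on with
  | empty => simpa using ReducesTo.zero
  | insert a s ha ih =>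
    rw [Finset.sum_insert ha, Finset.sum_insert ha]
    exact (h a (by simp)).add (ih fun i hi => h i (by simp [hi]))

theorem zmod_succ_ne_zero {k : ℕ} (h : k + 1 < p) : (k : ZMod p) + 1 ≠ 0 := by
  have : ((k + 1 : ℕ) : ZMod p) ≠ 0 := by
    rw [Ne, ZMod.natCast_eq_zero_iff]
    exact fun hd => absurd (Nat.le_of_dvd (by omega) hd) (by omega)
  exact_mod_cast this

theorem ReducesTo.inv_succ {k : ℕ} (h : k + 1 < p) :
    ReducesTo p (1 / ((k : ℚ) + 1)) (1 / ((k : ZMod p) + 1)) :=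
  ⟨1, k + 1, by push_cast; exact zmod_succ_ne_zero h, by push_cast; rfl, by push_cast; rfl⟩

theorem ReducesTo.inv_succ_pow {k : ℕ} (h : k + 1 < p) (s : ℕ) :
    ReducesTo p (1 / ((k : ℚ) + 1) ^ s) (1 / ((k : ZMod p) + 1) ^ s) := by
  rw [← one_div_pow, ← one_div_pow]
  exact (ReducesTo.inv_succ h).pow s

theorem ReducesTo.recipSum {n : ℕ} (h : n < p) (s : ℕ) :
    ReducesTo p (recipSum ℚ n s) (recipSum (ZMod p) n s) :=
  ReducesTo.sum fun k hk => ReducesTo.inv_succ_pow (by have := Finset.mem_range.1 hk; omega) s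

theorem ReducesTo.recipPairSum {n : ℕ} (h : n < p) :
    ReducesTo p (recipPairSum ℚ n) (recipPairSum (ZMod p) n) :=
  ReducesTo.sum fun k hk => by
    have := Finset.mem_range.1 hk
    exact (ReducesTo.inv_succ (by omega)).mul (ReducesTo.recipSum (by omega) 1)

theorem ReducesTo.padicGe_zero {x : ℚ} {z : ZMod p} (h : ReducesTo p x z) : PadicGe p 0 x := by
  obtain ⟨a, b, hb, rfl, rfl⟩ := h
  have hb' : PadicUnit p (b : ℚ) :=
    (padicNorm.int_eq_one_iff b).2 fun hd => hb ((ZMod.intCast_zmod_eq_zero_iff_dvd b p).2 hd)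
  rw [div_eq_mul_one_div]
  exact (padicGe_intCast a).mul_of_eq hb'.inv.ge (by ring)

theorem ReducesTo.padicGe_one {x : ℚ} (h : ReducesTo p x 0) : PadicGe p 1 x := by
  obtain ⟨a, b, hb, rfl, h0⟩ := h
  have hb' : PadicUnit p (b : ℚ) :=
    (padicNorm.int_eq_one_iff b).2 fun hd => hb ((ZMod.intCast_zmod_eq_zero_iff_dvd b p).2 hd)
  have ha : (a : ZMod p) = 0 := by
    rcases div_eq_zero_iff.1 h0.symm with h | h
    · exact h
    · exact absurd h hb
  obtain ⟨c, rfl⟩ := (ZMod.intCast_zmod_eq_zero_iff_dvd a p).1 ha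
  push_cast
  rw [mul_div_assoc, div_eq_mul_one_div]
  refine padicGe_one_self.mul_of_eq ((padicGe_intCast c).mul_of_eq hb'.inv.ge (k := 0) ?_) ?_ <;>
    norm_num

end Reduction

/-! ### Power sums over the nonzero residues. -/

section PowerSums

variable {p q : ℕ} [hp : Fact p.Prime]

theorem sum_range_eq_sum_zmod (hq : p = q + 1) (f : ZMod p → ZMod p) (h0 : f 0 = 0) :
    ∑ k ∈ Finset.range q, f ((k : ZMod p) + 1) = ∑ x, f x := by
  subst hq
  have h1 : ∑ x : ZMod (q + 1), f x = ∑ k ∈ Finset.range (q + 1), f (k : ZMod (q + 1)) := by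
    rw [Finset.sum_range]
    refine Finset.sum_congr rfl fun x _ => ?_
    congr 1
    exact (Fin.cast_val_eq_self x).symm
  rw [h1, Finset.sum_range_succ']
  simp [h0]

theorem sum_range_pow_zmod (hq : p = q + 1) {i : ℕ} (h0 : i ≠ 0) (hi : i < q) :
    ∑ k ∈ Finset.range q, ((k : ZMod p) + 1) ^ i = 0 := by
  rw [sum_range_eq_sum_zmod hq (fun x => x ^ i) (by simp [h0])]
  exact FiniteField.sum_pow_lt_card_sub_one _ i (by rw [ZMod.card]; omega)

theorem zmod_inv_pow (hq : p = q + 1) {k s : ℕ} (hk : k < q) (hs : s ≤ q) :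
    1 / ((k : ZMod p) + 1) ^ s = ((k : ZMod p) + 1) ^ (q - s) := by
  have h := zmod_succ_ne_zero (p := p) (k := k) (by omega)
  rw [div_eq_iff (pow_ne_zero _ h), ← pow_add, Nat.sub_add_cancel hs]
  have h1 := ZMod.pow_card_sub_one_eq_one h
  rw [show p - 1 = q by omega] at h1
  exact h1.symm

theorem recipSum_zmod_eq_zero (hq : p = q + 1) {s : ℕ} (h0 : s ≠ 0) (hs : s < q) :
    recipSum (ZMod p) q s = 0 := by
  rw [recipSum, Finset.sum_congr rfl fun k hk =>
    zmod_inv_pow hq (Finset.mem_range.1 hk) hs.le]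
  exact sum_range_pow_zmod hq (by omega) (by omega)

theorem sum_range_reflect_succ {K : Type*} [Field K] (f : K → K) (q : ℕ) :
    ∑ k ∈ Finset.range q, f ((q : K) + 1 - ((k : K) + 1)) = ∑ k ∈ Finset.range q, f ((k : K) + 1) := by
  rw [← Finset.sum_range_reflect (fun k => f ((k : K) + 1))]
  refine Finset.sum_congr rfl fun k hk => ?_
  have := Finset.mem_range.1 hk
  congr 1
  rw [Nat.sub_sub, Nat.cast_sub (by omega)]
  push_cast
  ring

end PowerSums

/-! ### Harmonic numbers through binomial coefficients. -/

section BinomialHarmonic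

variable {K : Type*} [Field K]

theorem alternating_sum_choose_succ (n : ℕ) :
    ∑ k ∈ Finset.range (n + 1), (-1 : K) ^ k * (n + 1).choose (k + 1) = 1 := by
  have h := Int.alternating_sum_range_choose (n := n + 1)
  rw [Finset.sum_range_succ'] at h
  have h' := congrArg (Int.cast : ℤ → K) h
  push_cast at h'
  simp only [pow_succ, mul_neg, mul_one, neg_mul, Finset.sum_neg_distrib,
    Nat.choose_zero_right, Nat.cast_one] at h'
  linear_combination -h'

/-- `∑_{k=1}^{n} (-1)^(k-1) C(n,k) / k = H_n`. -/
theorem sum_choose_div_eq_recipSum (n : ℕ) (h : ∀ k < n, (k : K) + 1 ≠ 0) :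
    ∑ k ∈ Finset.range n, (-1 : K) ^ k * n.choose (k + 1) / ((k : K) + 1) = recipSum K n 1 := by
  induction n with
  | zero => simp [recipSum]
  | succ n ih =>
    have hn := h n (by omega)
    -- The increment is spread over the alternating binomial sum, so that the induction step becomes
    -- Pascal's rule term by term.
    have h5 : 1 / ((n : K) + 1) ^ 1 = ∑ k ∈ Finset.range (n + 1),
        (-1 : K) ^ k * (n + 1).choose (k + 1) / ((n : K) + 1) := by
      rw [← Finset.sum_div, alternating_sum_choose_succ, pow_one]
    rw [recipSum_succ, ← ih fun k hk => h k (by omega), h5]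
    have h0 : ∑ k ∈ Finset.range n, (-1 : K) ^ k * n.choose (k + 1) / ((k : K) + 1)
        = ∑ k ∈ Finset.range (n + 1), (-1 : K) ^ k * n.choose (k + 1) / ((k : K) + 1) := by
      rw [Finset.sum_range_succ]
      simp
    rw [h0, ← Finset.sum_add_distrib]
    refine Finset.sum_congr rfl fun k hk => ?_
    have hk' := h k (Finset.mem_range.1 hk)
    have h1 : ((n : K) + 1) * n.choose k = (n + 1).choose (k + 1) * ((k : K) + 1) := by
      have := congrArg (Nat.cast : ℕ → K) (Nat.add_one_mul_choose_eq n k)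
      push_cast at this
      exact this
    have h2 : ((n + 1).choose (k + 1) : K) = n.choose k + n.choose (k + 1) := by
      rw [Nat.choose_succ_succ, Nat.cast_add]
    field_simp
    linear_combination ((n : K) + 1) * h2 + h1

theorem choose_eq_prod (n k : ℕ) (h : ∀ j ≤ k, (j : K) + 1 ≠ 0) :
    (-1 : K) ^ k * n.choose (k + 1)
      = n / ((k : K) + 1) * ∏ j ∈ Finset.range k, (1 - n / ((j : K) + 1)) := by
  induction k with
  | zero => simp
  | succ k ih =>
    have hk := h k (by omega)
    have hk1 := h (k + 1) le_rfl
    have ih := ih fun j hj => h j (by omega)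
    have h1 : (n.choose (k + 2) : K) * ((k + 1 : ℕ) + 1) = n.choose (k + 1) * (n - ((k : K) + 1)) := by
      rcases Nat.lt_or_ge n (k + 1) with hlt | hge
      · rw [Nat.choose_eq_zero_of_lt hlt, Nat.choose_eq_zero_of_lt (by omega)]
        simp
      · have := Nat.choose_succ_right_eq n (k + 1)
        have h2 := congrArg (Nat.cast : ℕ → K) this
        rw [Nat.cast_mul, Nat.cast_mul, Nat.cast_sub hge] at h2
        push_cast at h2 ⊢
        exact h2
    rw [Finset.prod_range_succ, pow_succ]
    rw [div_mul_eq_mul_div, eq_div_iff hk] at ih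
    rw [div_mul_eq_mul_div, eq_div_iff hk1]
    have h3 : (1 - (n : K) / ((k : K) + 1)) = ((k : K) + 1 - n) / ((k : K) + 1) := by
      field_simp
    rw [h3, mul_div_assoc', mul_div_assoc', eq_div_iff hk]
    linear_combination (-(-1) ^ k * ((k : K) + 1)) * h1 + ((k : K) + 1 - n) * ih

/-- Makes the dependence on `n` polynomial in each term. It serves twice: in `ZMod p` with `n` as a
variable to be summed over, and in `ℚ` with `n = p` as a small parameter. -/
theorem recipSum_one_eq_sum_prod (n : ℕ) (h : ∀ k < n, (k : K) + 1 ≠ 0) :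
    recipSum K n 1 = ∑ k ∈ Finset.range n, n / ((k : K) + 1) ^ 2 *
      ∏ j ∈ Finset.range k, (1 - n / ((j : K) + 1)) := by
  rw [← sum_choose_div_eq_recipSum n h]
  refine Finset.sum_congr rfl fun k hk => ?_
  have hk := Finset.mem_range.1 hk
  have hk' := h k hk
  rw [choose_eq_prod n k fun j hj => h j (by omega)]
  field_simp

open Polynomial in
theorem coeff_prod_one_sub (k : ℕ) :
    let Q : K[X] := ∏ j ∈ Finset.range k, (1 - C (1 / ((j : K) + 1)) * X)
    Q.natDegree ≤ k ∧ Q.coeff 0 = 1 ∧ Q.coeff 1 = -recipSum K k 1 ∧ Q.coeff 2 = recipPairSum K k := by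
  induction k with
  | zero => simp [recipSum, recipPairSum, coeff_one]
  | succ k ih =>
    obtain ⟨h, h0, h1, h2⟩ := ih
    simp only [Finset.prod_range_succ]
    set Q : K[X] := ∏ j ∈ Finset.range k, (1 - C (1 / ((j : K) + 1)) * X)
    have e : Q * (1 - C (1 / ((k : K) + 1)) * X) = Q - C (1 / ((k : K) + 1)) * (Q * X) := by ring
    refine ⟨?_, ?_, ?_, ?_⟩
    · refine natDegree_mul_le.trans (add_le_add h ?_)
      compute_degree
    · rw [e]
      simp [h0]
    · rw [e, coeff_sub, coeff_C_mul, coeff_mul_X, h0, h1, recipSum_succ]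
      ring
    · rw [e, coeff_sub, coeff_C_mul, coeff_mul_X, h1, h2, recipPairSum_succ]
      ring

end BinomialHarmonic

/-! ### Vanishing of harmonic double and triple sums modulo `p`. -/

section ModP

variable {p q : ℕ} [hp : Fact p.Prime]

theorem zmod_q (hq : p = q + 1) : (q : ZMod p) = -1 := by
  have h : ((q + 1 : ℕ) : ZMod p) = 0 := by rw [← hq]; simp
  push_cast at h
  linear_combination h

open Polynomial in
-- The sum of `m^(i-2)` over nonzero residues vanishes unless `p - 1` divides `i - 2`; in degrees
-- below `p - 1` only `i = 2` survives, giving `p - 1 = -1`.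
theorem sum_div_sq_eval (hq : p = q + 1) (h3 : 3 < q) (Q : (ZMod p)[X]) (hQ : Q.natDegree < q) :
    ∑ m ∈ Finset.range q, 1 / ((m : ZMod p) + 1) ^ 2 * Q.eval ((m : ZMod p) + 1) = -Q.coeff 2 := by
  have h1 : ∀ i < q, ∑ m ∈ Finset.range q, 1 / ((m : ZMod p) + 1) ^ 2 * ((m : ZMod p) + 1) ^ i
      = if i = 2 then -1 else 0 := by
    intro i hi
    rcases lt_trichotomy i 2 with h | rfl | h
    · rw [if_neg h.ne, Finset.sum_congr rfl fun m hm => by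
        rw [zmod_inv_pow hq (Finset.mem_range.1 hm) (by omega), ← pow_add]]
      exact sum_range_pow_zmod hq (by omega) (by omega)
    · rw [if_pos rfl, Finset.sum_congr rfl fun m hm => by
        rw [one_div_mul_cancel (pow_ne_zero _ (zmod_succ_ne_zero (by
          have := Finset.mem_range.1 hm; omega)))]]
      simp [zmod_q hq]
    · rw [if_neg h.ne']
      obtain ⟨j, rfl⟩ := Nat.exists_eq_add_of_lt h
      rw [Finset.sum_congr rfl fun m hm => by
        rw [show 2 + j + 1 = 2 + (j + 1) by ring, pow_add, ← mul_assoc,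
          one_div_mul_cancel (pow_ne_zero _ (zmod_succ_ne_zero (by
          have := Finset.mem_range.1 hm; omega))), one_mul]]
      exact sum_range_pow_zmod hq (by omega) (by omega)
  simp only [eval_eq_sum_range' hQ, Finset.mul_sum]
  rw [Finset.sum_comm]
  rw [Finset.sum_congr rfl fun i hi => by
    rw [Finset.sum_congr rfl fun m _ => by rw [mul_left_comm], ← Finset.mul_sum,
      h1 i (Finset.mem_range.1 hi)]]
  simp only [mul_ite, mul_neg, mul_one, mul_zero, Finset.sum_ite_eq', Finset.mem_range]
  rw [if_pos (by omega)]

theorem recipSum_zmod_reflect (hq : p = q + 1) (h3 : 3 < q) {m : ℕ} (hm : m ≤ q) :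
    recipSum (ZMod p) (q - m) 1 = recipSum (ZMod p) m 1 := by
  induction m with
  | zero => rw [recipSum_zero, Nat.sub_zero, recipSum_zmod_eq_zero hq] <;> omega
  | succ m ih =>
    have ih := ih (by omega)
    rw [show q - m = (q - (m + 1)) + 1 by omega, recipSum_succ] at ih
    rw [recipSum_succ, ← ih, Nat.cast_sub hm, zmod_q hq, pow_one, pow_one]
    push_cast
    have h := zmod_succ_ne_zero (p := p) (k := m) (by omega)
    have h' : (-1 - ((m : ZMod p) + 1) + 1) = -((m : ZMod p) + 1) := by ring
    rw [h', one_div_neg_eq_neg_one_div]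
    ring

theorem two_ne_zero_zmod (h : 2 < p) : (2 : ZMod p) ≠ 0 := by
  have := zmod_succ_ne_zero (p := p) (k := 1) (by omega)
  norm_num at this
  exact this

/-- Reflection `m ↦ p - m` gives `W = -∑ H_{m-1}/m³`, while splitting off the last term of `H_m`
gives `W = ∑ H_{m-1}/m³ + H_{p-1}(4)`. Adding, `2W = 0`. -/
theorem sum_recipSum_div_cube (hq : p = q + 1) (h3 : 4 < q) :
    ∑ m ∈ Finset.range q, 1 / ((m : ZMod p) + 1) ^ 3 * recipSum (ZMod p) (m + 1) 1 = 0 := by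
  set W := ∑ m ∈ Finset.range q, 1 / ((m : ZMod p) + 1) ^ 3 * recipSum (ZMod p) (m + 1) 1 with hW
  have h1 : W = -∑ m ∈ Finset.range q, 1 / ((m : ZMod p) + 1) ^ 3 * recipSum (ZMod p) m 1 := by
    rw [hW, ← Finset.sum_range_reflect, ← Finset.sum_neg_distrib]
    refine Finset.sum_congr rfl fun m hm => ?_
    have hm := Finset.mem_range.1 hm
    rw [show q - 1 - m + 1 = q - m by omega, recipSum_zmod_reflect hq (by omega) hm.le,
      show q - 1 - m = q - (m + 1) by omega, Nat.cast_sub (by omega), zmod_q hq]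
    push_cast
    have h' : (-1 - ((m : ZMod p) + 1) + 1) = -((m : ZMod p) + 1) := by ring
    rw [h', neg_pow, show (-1 : ZMod p) ^ 3 = -1 by norm_num, neg_one_mul,
      one_div_neg_eq_neg_one_div, neg_mul]
  have h2 : W = ∑ m ∈ Finset.range q, 1 / ((m : ZMod p) + 1) ^ 3 * recipSum (ZMod p) m 1
      + recipSum (ZMod p) q 4 := by
    rw [hW, recipSum, ← Finset.sum_add_distrib]
    refine Finset.sum_congr rfl fun m hm => ?_
    have h := zmod_succ_ne_zero (p := p) (k := m) (by have := Finset.mem_range.1 hm; omega)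
    rw [recipSum_succ]
    field_simp
  rw [recipSum_zmod_eq_zero hq (by omega) h3, add_zero] at h2
  have h4 : 2 * W = 0 := by linear_combination h1 + h2
  exact (mul_eq_zero.1 h4).resolve_left (two_ne_zero_zmod (by omega))

/-- Insert the polynomial form of `H_m` into `∑ H_m/m³ = 0` and sum over `m` first:
`sum_div_sq_eval` extracts from `∏ (1 - m/j)` its quadratic coefficient, which is the pair sum. -/
theorem sum_recipPairSum_div_sq (hq : p = q + 1) (h3 : 4 < q) :
    ∑ k ∈ Finset.range q, 1 / ((k : ZMod p) + 1) ^ 2 * recipPairSum (ZMod p) k = 0 := by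
  have hne : ∀ k < q, (k : ZMod p) + 1 ≠ 0 := fun k hk => zmod_succ_ne_zero (by omega)
  have h1 : ∀ m < q, recipSum (ZMod p) (m + 1) 1 = ∑ k ∈ Finset.range q,
      ((m : ZMod p) + 1) / ((k : ZMod p) + 1) ^ 2 *
        ∏ j ∈ Finset.range k, (1 - ((m : ZMod p) + 1) / ((j : ZMod p) + 1)) := by
    intro m hm
    rw [recipSum_one_eq_sum_prod (m + 1) fun k hk => hne k (by omega)]
    push_cast
    -- The terms added with larger `k` are zero, since their product contains the factor `j = m`.
    -- This makes the range of `k` independent of `m`.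
    refine Finset.sum_subset (Finset.range_mono (by omega)) fun k _ hk => ?_
    rw [Finset.prod_eq_zero (i := m), mul_zero]
    · simp only [Finset.mem_range] at hk ⊢; omega
    · rw [div_self (hne m hm), sub_self]
  have h2 := sum_recipSum_div_cube hq h3
  rw [Finset.sum_congr rfl fun m hm => by
    rw [h1 m (Finset.mem_range.1 hm), Finset.mul_sum], Finset.sum_comm] at h2
  rw [← neg_eq_zero, ← h2, ← Finset.sum_neg_distrib]
  refine Finset.sum_congr rfl fun k hk => ?_
  have hk := Finset.mem_range.1 hk
  obtain ⟨hd, -, -, hc⟩ := coeff_prod_one_sub (K := ZMod p) k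
  rw [← mul_neg, ← hc, ← sum_div_sq_eval hq (by omega) _ (by omega), Finset.mul_sum]
  refine Finset.sum_congr rfl fun m hm => ?_
  have hm := hne m (Finset.mem_range.1 hm)
  have hk' := hne k hk
  rw [Polynomial.eval_prod]
  simp only [Polynomial.eval_sub, Polynomial.eval_one, Polynomial.eval_mul, Polynomial.eval_C,
    Polynomial.eval_X, one_div_mul_eq_div]
  field_simp

/-- Under `k ↦ p - k` the fourth power is unchanged and the sign flips, `p` being odd. -/
theorem alternating_recip_four_zmod (hq : p = q + 1) (h3 : 4 < q) :
    ∑ k ∈ Finset.range q, (-1 : ZMod p) ^ k / ((k : ZMod p) + 1) ^ 4 = 0 := by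
  set B := ∑ k ∈ Finset.range q, (-1 : ZMod p) ^ k / ((k : ZMod p) + 1) ^ 4 with hB
  have hodd : Odd p := hp.out.odd_of_ne_two (by omega)
  have heven : Even q := by
    rw [hq] at hodd
    exact (Nat.even_add_one.not_left.1 (by simpa using hodd))
  have h1 : B = -B := by
    conv_lhs => rw [hB, ← Finset.sum_range_reflect]
    rw [hB, ← Finset.sum_neg_distrib]
    refine Finset.sum_congr rfl fun m hm => ?_
    have hm := Finset.mem_range.1 hm
    have hs : (-1 : ZMod p) ^ (q - 1 - m) = -(-1) ^ m := by
      have : (-1 : ZMod p) ^ (q - 1 - m) * (-1) ^ (m + 1) = 1 := by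
        rw [← pow_add, show q - 1 - m + (m + 1) = q by omega, heven.neg_one_pow]
      have h4 : ((-1 : ZMod p) ^ m) * (-1) ^ m = 1 := by rw [← mul_pow]; simp
      rw [pow_succ] at this
      linear_combination -(-1 : ZMod p) ^ m * this - (-1 : ZMod p) ^ (q - 1 - m) * h4
    rw [hs, show q - 1 - m = q - (m + 1) by omega, Nat.cast_sub (by omega), zmod_q hq]
    push_cast
    have h' : (-1 - ((m : ZMod p) + 1) + 1) = -((m : ZMod p) + 1) := by ring
    rw [h', Even.neg_pow (by decide : Even 4), neg_div]
  have h4 : 2 * B = 0 := by linear_combination h1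
  exact (mul_eq_zero.1 h4).resolve_left (two_ne_zero_zmod (by omega))

end ModP

/-! ### Exact identities between harmonic sums. -/

/-- The sum `∑ H_{n-1}(1) / n ^ 2` for `1 ≤ n ≤ q`. -/
def recipDoubleSum (q : ℕ) : ℚ := ∑ k ∈ Finset.range q, 1 / ((k : ℚ) + 1) ^ 2 * recipSum ℚ k 1

/-- The alternating sum `∑ (-1) ^ (n - 1) / n ^ s` for `1 ≤ n ≤ q`. -/
def altRecipSum (q s : ℕ) : ℚ := ∑ k ∈ Finset.range q, (-1) ^ k / ((k : ℚ) + 1) ^ s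

section ExactIdentities

theorem sum_range_reflect_rat (f : ℚ → ℚ) (N : ℕ) :
    ∑ j ∈ Finset.range N, f ((N : ℚ) - j) = ∑ j ∈ Finset.range N, f ((j : ℚ) + 1) := by
  rw [← sum_range_reflect_succ f N]
  refine Finset.sum_congr rfl fun j _ => ?_
  congr 1
  ring

theorem sum_recipSum_two_div_sub (N : ℕ) :
    ∑ k ∈ Finset.range N, recipSum ℚ k 2 / ((N : ℚ) - k)
      = ∑ n ∈ Finset.range N, (recipSum ℚ n 2 / ((n : ℚ) + 1)
        + 2 * (1 / ((n : ℚ) + 1) ^ 2 * recipSum ℚ n 1)) := by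
  have h : ∀ N : ℕ, ∑ k ∈ Finset.range N, recipSum ℚ k 2 / ((N : ℚ) - k)
      = ∑ j ∈ Finset.range N, recipSum ℚ (N - 1 - j) 2 / ((j : ℚ) + 1) := by
    intro N
    rw [← Finset.sum_range_reflect]
    refine Finset.sum_congr rfl fun j hj => ?_
    have hj := Finset.mem_range.1 hj
    congr 1
    rw [Nat.sub_sub, Nat.cast_sub (by omega)]
    push_cast
    ring
  induction N with
  | zero => simp
  | succ N ih =>
    rw [Finset.sum_range_succ (fun n => recipSum ℚ n 2 / ((n : ℚ) + 1) + _), ← ih, h, h,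
      Finset.sum_range_succ, Nat.add_sub_cancel, Nat.sub_self, recipSum_zero, zero_div, add_zero]
    -- Partial fractions for `1/(a² b)` with `a = N - j`, `b = j + 1`, where `a + b = N + 1` does
    -- not depend on `j`.
    have e : ∀ j ∈ Finset.range N, recipSum ℚ (N - j) 2 / ((j : ℚ) + 1)
        = recipSum ℚ (N - 1 - j) 2 / ((j : ℚ) + 1)
          + (1 / ((N : ℚ) + 1) * (1 / ((N : ℚ) - j) ^ 2)
          + 1 / ((N : ℚ) + 1) ^ 2 * (1 / ((N : ℚ) - j) ^ 1 + 1 / ((j : ℚ) + 1) ^ 1)) := by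
      intro j hj
      have hj := Finset.mem_range.1 hj
      have h1 : N - j = N - 1 - j + 1 := by omega
      have h2 : ((N - 1 - j : ℕ) : ℚ) + 1 = N - j := by
        rw [← Nat.cast_sub hj.le, h1]
        push_cast
        ring
      have h3 : (N : ℚ) - j ≠ 0 := by
        rw [← h2]; positivity
      rw [h1, recipSum_succ, h2]
      field_simp
      ring
    rw [Finset.sum_congr rfl e, Finset.sum_add_distrib, Finset.sum_add_distrib, ← Finset.mul_sum,
      ← Finset.mul_sum, Finset.sum_add_distrib, sum_range_reflect_rat (fun x => 1 / x ^ 2),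
      sum_range_reflect_rat (fun x => 1 / x ^ 1)]
    unfold recipSum
    ring

theorem sum_recipSum_shuffle (N : ℕ) :
    ∑ n ∈ Finset.range N, (recipSum ℚ n 2 / ((n : ℚ) + 1) + 1 / ((n : ℚ) + 1) ^ 2 * recipSum ℚ n 1)
      = recipSum ℚ N 1 * recipSum ℚ N 2 - recipSum ℚ N 3 := by
  induction N with
  | zero => simp [recipSum]
  | succ N ih =>
    rw [Finset.sum_range_succ, ih, recipSum_succ, recipSum_succ, recipSum_succ]
    field_simp
    ring

theorem sum_even_recip (N : ℕ) :
    ∑ n ∈ Finset.range (2 * N + 1), (1 - (-1 : ℚ) ^ n) / ((n : ℚ) + 1) = recipSum ℚ N 1 := by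
  induction N with
  | zero => simp [recipSum]
  | succ N ih =>
    have h1 : (-1 : ℚ) ^ (2 * N + 1) = -1 := (odd_two_mul_add_one N).neg_one_pow
    have h2 : (-1 : ℚ) ^ (2 * N + 1 + 1) = 1 := by rw [pow_succ, h1]; norm_num
    rw [show 2 * (N + 1) + 1 = 2 * N + 1 + 1 + 1 by ring, Finset.sum_range_succ,
      Finset.sum_range_succ, ih, recipSum_succ, h1, h2]
    push_cast
    field_simp
    ring

/-- `H_q` is the sum of `2/m` over even `m ≤ 2q + 1`. With `p = q + 1` odd, these `m` are the
numbers `p ± j` with `j` odd and `j < p`; the central `m = p` has weight zero. -/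
theorem recipSum_one_eq_sum_odd {q : ℕ} (hq : Even q) :
    recipSum ℚ q 1 = ∑ k ∈ Finset.range q, (1 + (-1 : ℚ) ^ k) *
      (1 / ((q : ℚ) + 1 - (k + 1)) + 1 / ((q : ℚ) + 1 + (k + 1))) := by
  have hs : (-1 : ℚ) ^ q = 1 := hq.neg_one_pow
  rw [← sum_even_recip, show 2 * q + 1 = q + 1 + q by ring, Finset.sum_range_add,
    Finset.sum_range_succ, hs, sub_self, zero_div, add_zero, ← Finset.sum_range_reflect,
    ← Finset.sum_add_distrib]
  refine Finset.sum_congr rfl fun k hk => ?_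
  have hk := Finset.mem_range.1 hk
  have h1 : (-1 : ℚ) ^ (q - 1 - k) = -(-1) ^ k := by
    have h2 : (-1 : ℚ) ^ (q - 1 - k) * (-1) ^ (k + 1) = 1 := by
      rw [← pow_add, show q - 1 - k + (k + 1) = q by omega, hs]
    have h4 : ((-1 : ℚ) ^ k) * (-1) ^ k = 1 := by rw [← mul_pow]; simp
    rw [pow_succ] at h2
    linear_combination -(-1 : ℚ) ^ k * h2 - (-1 : ℚ) ^ (q - 1 - k) * h4
  rw [h1, pow_add, pow_succ, hs, Nat.sub_sub, Nat.cast_sub (by omega)]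
  push_cast
  ring

end ExactIdentities

/-! ### Harmonic sums modulo powers of `p`. -/

section Congruences

set_option linter.unusedSectionVars false

variable {p q : ℕ} [hp : Fact p.Prime]

theorem cast_prime_eq (hq : p = q + 1) : (p : ℚ) = q + 1 := by rw [hq]; push_cast; ring

theorem padicGe_recipSum (hq : p = q + 1) {k : ℕ} (hk : k ≤ q) (s : ℕ) :
    PadicGe p 0 (recipSum ℚ k s) := (ReducesTo.recipSum (by omega) s).padicGe_zero

theorem padicGe_recipSum_one_of_lt (hq : p = q + 1) {s : ℕ} (h0 : s ≠ 0) (hs : s < q) :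
    PadicGe p 1 (recipSum ℚ q s) := by
  have := ReducesTo.recipSum (p := p) (n := q) (by omega) s
  rw [recipSum_zmod_eq_zero hq h0 hs] at this
  exact this.padicGe_one

theorem padicGe_altRecipSum_four (hq : p = q + 1) (h3 : 4 < q) : PadicGe p 1 (altRecipSum q 4) := by
  refine ReducesTo.padicGe_one ?_
  rw [← alternating_recip_four_zmod hq h3]
  refine ReducesTo.sum fun k hk => ?_
  have := Finset.mem_range.1 hk
  rw [div_eq_mul_one_div, div_eq_mul_one_div ((-1 : ZMod p) ^ k)]
  refine ReducesTo.mul (ReducesTo.pow ?_ k) (ReducesTo.inv_succ_pow (by omega) 4)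
  simpa using ReducesTo.intCast (p := p) (-1)

theorem padicUnit_two (h : 2 < p) : PadicUnit p (2 : ℚ) := by
  exact_mod_cast padicUnit_of_pos_of_lt (p := p) (k := 2) (by omega) h

theorem padicUnit_sub_succ {k : ℕ} (h : k + 1 < p) : PadicUnit p ((p : ℚ) - (k + 1)) := by
  have := ((padicUnit_succ h).sub_of_ge padicGe_one_self).neg
  rwa [neg_sub] at this

theorem padicUnit_add_succ {k : ℕ} (h : k + 1 < p) : PadicUnit p ((p : ℚ) + (k + 1)) := by
  rw [add_comm]
  exact (padicUnit_succ h).add_of_ge padicGe_one_self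

theorem recipSum_reflect (hq : p = q + 1) (s : ℕ) :
    recipSum ℚ q s = ∑ k ∈ Finset.range q, 1 / ((p : ℚ) - (k + 1)) ^ s := by
  rw [cast_prime_eq hq, sum_range_reflect_succ (fun x : ℚ => 1 / x ^ s)]
  rfl

/-- Pairing `k` with `p - k` gives `2 H(3) ≡ -3p H(4)` modulo `p²`, and `p` divides `H(4)` because
`4 < p - 1`. -/
theorem padicGe_recipSum_three (hq : p = q + 1) (h3 : 4 < q) : PadicGe p 2 (recipSum ℚ q 3) := by
  have h1 : PadicGe p 2 (2 * recipSum ℚ q 3 + 3 * (p * recipSum ℚ q 4)) := by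
    have e : 2 * recipSum ℚ q 3 + 3 * (p * recipSum ℚ q 4) = ∑ k ∈ Finset.range q,
        (1 / ((k : ℚ) + 1) ^ 3 + 1 / ((p : ℚ) - (k + 1)) ^ 3 + 3 * p * (1 / ((k : ℚ) + 1) ^ 4)) := by
      rw [Finset.sum_add_distrib, Finset.sum_add_distrib, ← recipSum_reflect hq, ← Finset.mul_sum]
      unfold recipSum
      ring
    rw [e]
    refine PadicGe.sum fun k hk => ?_
    have hk := Finset.mem_range.1 hk
    have hx := padicUnit_succ (p := p) (k := k) (by omega)
    have hy := padicUnit_sub_succ (p := p) (k := k) (by omega)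
    have hx0 := hx.ne_zero
    have hy0 := hy.ne_zero
    have e2 : 1 / ((k : ℚ) + 1) ^ 3 + 1 / ((p : ℚ) - (k + 1)) ^ 3 + 3 * p * (1 / ((k : ℚ) + 1) ^ 4)
        = p ^ 2 * (((3 * p ^ 2 - 8 * p * (k + 1) + 6 * (k + 1) ^ 2 : ℤ) : ℚ)
          * (1 / (((k : ℚ) + 1) ^ 4 * ((p : ℚ) - (k + 1)) ^ 3))) := by
      push_cast
      field_simp
      ring
    rw [e2]
    exact (padicGe_pow_self 2).mul_of_eq
      ((padicGe_intCast _).int_mul ((hx.pow 4).mul (hy.pow 3)).inv.ge) (by norm_num)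
  have h4 : PadicGe p 2 (3 * (p * recipSum ℚ q 4)) := by
    have h5 : PadicGe p 0 (3 : ℚ) := by exact_mod_cast padicGe_natCast (p := p) 3
    exact h5.int_mul (padicGe_one_self.mul_of_eq
      (padicGe_recipSum_one_of_lt hq (by omega) h3) (by norm_num))
  refine PadicGe.of_mul_unit (padicUnit_two (by omega)) ?_
  have := h1.sub h4
  rwa [add_sub_cancel_right] at this

/-- Expand `1/(p - k)` as a geometric series in `p/k`; the terms `p² H(3)` and `p³ H(4)` are already
divisible by `p⁴`. -/
theorem padicGe_two_recipSum_one_add (hq : p = q + 1) (h3 : 4 < q) :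
    PadicGe p 4 (2 * recipSum ℚ q 1 + p * recipSum ℚ q 2) := by
  have h1 : PadicGe p 4 (2 * recipSum ℚ q 1 + p * recipSum ℚ q 2 + p ^ 2 * recipSum ℚ q 3
      + p ^ 3 * recipSum ℚ q 4) := by
    have e : 2 * recipSum ℚ q 1 + p * recipSum ℚ q 2 + p ^ 2 * recipSum ℚ q 3
        + p ^ 3 * recipSum ℚ q 4 = ∑ k ∈ Finset.range q,
        (1 / ((k : ℚ) + 1) ^ 1 + 1 / ((p : ℚ) - (k + 1)) ^ 1 + p * (1 / ((k : ℚ) + 1) ^ 2)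
          + p ^ 2 * (1 / ((k : ℚ) + 1) ^ 3) + p ^ 3 * (1 / ((k : ℚ) + 1) ^ 4)) := by
      simp only [Finset.sum_add_distrib]
      rw [← recipSum_reflect hq, ← Finset.mul_sum, ← Finset.mul_sum, ← Finset.mul_sum]
      unfold recipSum
      ring
    rw [e]
    refine PadicGe.sum fun k hk => ?_
    have hk := Finset.mem_range.1 hk
    have hx := padicUnit_succ (p := p) (k := k) (by omega)
    have hy := padicUnit_sub_succ (p := p) (k := k) (by omega)
    have hx0 := hx.ne_zero
    have hy0 := hy.ne_zero
    have e2 : 1 / ((k : ℚ) + 1) ^ 1 + 1 / ((p : ℚ) - (k + 1)) ^ 1 + p * (1 / ((k : ℚ) + 1) ^ 2)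
          + p ^ 2 * (1 / ((k : ℚ) + 1) ^ 3) + p ^ 3 * (1 / ((k : ℚ) + 1) ^ 4)
        = p ^ 4 * (1 / (((k : ℚ) + 1) ^ 4 * ((p : ℚ) - (k + 1)))) := by
      field_simp
      ring
    rw [e2]
    exact (padicGe_pow_self 4).mul_of_eq ((hx.pow 4).mul hy).inv.ge (by norm_num)
  have h4 : PadicGe p 4 ((p : ℚ) ^ 2 * recipSum ℚ q 3) :=
    (padicGe_pow_self 2).mul_of_eq (padicGe_recipSum_three hq h3) (by norm_num)
  have h5 : PadicGe p 4 ((p : ℚ) ^ 3 * recipSum ℚ q 4) :=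
    (padicGe_pow_self 3).mul_of_eq (padicGe_recipSum_one_of_lt hq (by omega) h3) (by norm_num)
  have := (h1.sub h5).sub h4
  rwa [add_sub_cancel_right, add_sub_cancel_right] at this

theorem padicGe_recipSum_one (hq : p = q + 1) (h3 : 4 < q) : PadicGe p 2 (recipSum ℚ q 1) := by
  have h1 : PadicGe p 2 (p * recipSum ℚ q 2) :=
    padicGe_one_self.mul_of_eq (padicGe_recipSum_one_of_lt hq (by omega) (by omega)) (by norm_num)
  have h2 := ((padicGe_two_recipSum_one_add hq h3).mono (n := 2) (by norm_num)).sub h1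
  rw [add_sub_cancel_right] at h2
  exact h2.of_mul_unit (padicUnit_two (by omega))

theorem even_pred_prime (hq : p = q + 1) (h : 2 < p) : Even q := by
  have hodd : Odd p := hp.out.odd_of_ne_two (by omega)
  rw [hq] at hodd
  exact Nat.even_add_one.not_left.1 (by simpa using hodd)

/-- `∑ (-1)^(n-1)/n² ≡ -(3/4) H_{p-1}(2)` modulo `p³`. -/
theorem padicGe_altRecipSum_two (hq : p = q + 1) (h3 : 4 < q) :
    PadicGe p 3 (4 * altRecipSum q 2 + 3 * recipSum ℚ q 2) := by
  -- From `1/(p-k) + 1/(p+k) = 2p/(p² - k²)`, expanded as `-2p/k² - 2p³/k⁴` up to higher order.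
  have h1 : PadicGe p 4 (recipSum ℚ q 1 + 2 * p * (recipSum ℚ q 2 + altRecipSum q 2)
      + 2 * p ^ 3 * (recipSum ℚ q 4 + altRecipSum q 4)) := by
    have e : recipSum ℚ q 1 + 2 * p * (recipSum ℚ q 2 + altRecipSum q 2)
      + 2 * p ^ 3 * (recipSum ℚ q 4 + altRecipSum q 4) = ∑ k ∈ Finset.range q,
        ((1 + (-1 : ℚ) ^ k) * (1 / ((p : ℚ) - (k + 1)) + 1 / ((p : ℚ) + (k + 1)))
          + 2 * p * (1 / ((k : ℚ) + 1) ^ 2 + (-1) ^ k / ((k : ℚ) + 1) ^ 2)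
          + 2 * p ^ 3 * (1 / ((k : ℚ) + 1) ^ 4 + (-1) ^ k / ((k : ℚ) + 1) ^ 4)) := by
      rw [Finset.sum_add_distrib, Finset.sum_add_distrib, ← Finset.mul_sum, ← Finset.mul_sum,
        Finset.sum_add_distrib, Finset.sum_add_distrib, cast_prime_eq hq,
        ← recipSum_one_eq_sum_odd (even_pred_prime hq (by omega))]
      rfl
    rw [e]
    refine PadicGe.sum fun k hk => ?_
    have hk := Finset.mem_range.1 hk
    have hx := padicUnit_succ (p := p) (k := k) (by omega)
    have hy := padicUnit_sub_succ (p := p) (k := k) (by omega)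
    have hz := padicUnit_add_succ (p := p) (k := k) (by omega)
    have hx0 := hx.ne_zero
    have hy0 := hy.ne_zero
    have hz0 := hz.ne_zero
    have e2 : (1 + (-1 : ℚ) ^ k) * (1 / ((p : ℚ) - (k + 1)) + 1 / ((p : ℚ) + (k + 1)))
          + 2 * p * (1 / ((k : ℚ) + 1) ^ 2 + (-1) ^ k / ((k : ℚ) + 1) ^ 2)
          + 2 * p ^ 3 * (1 / ((k : ℚ) + 1) ^ 4 + (-1) ^ k / ((k : ℚ) + 1) ^ 4)
        = p ^ 4 * (((2 * p * (1 + (-1) ^ k) : ℤ) : ℚ) *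
          (1 / (((k : ℚ) + 1) ^ 4 * (((p : ℚ) - (k + 1)) * ((p : ℚ) + (k + 1)))))) := by
      push_cast
      field_simp
      ring
    rw [e2]
    exact (padicGe_pow_self 4).mul_of_eq
      ((padicGe_intCast _).int_mul ((hx.pow 4).mul (hy.mul hz)).inv.ge) (by norm_num)
  have h2 : PadicGe p 4 (2 * p ^ 3 * (recipSum ℚ q 4 + altRecipSum q 4)) := by
    have h5 : PadicGe p 0 (2 : ℚ) := by exact_mod_cast padicGe_natCast (p := p) 2
    exact (h5.int_mul (padicGe_pow_self 3)).mul_of_eq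
      ((padicGe_recipSum_one_of_lt hq (by omega) h3).add (padicGe_altRecipSum_four hq h3))
      (by norm_num)
  -- Doubling allows `2 H(1) + p H(2)` to be subtracted, leaving `p` times the claim.
  have h4 := (h1.sub h2).add (h1.sub h2)
  have h5 := (h4.sub (padicGe_two_recipSum_one_add hq h3))
  refine PadicGe.mono (PadicGe.of_pow_mul (n := 4) 1 ?_) (by norm_num)
  convert h5 using 1
  ring

theorem padicGe_prod_one_sub (hq : p = q + 1) {k : ℕ} (hk : k ≤ q) :
    PadicGe p 3 (∏ j ∈ Finset.range k, (1 - (p : ℚ) / ((j : ℚ) + 1))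
      - (1 - p * recipSum ℚ k 1 + p ^ 2 * recipPairSum ℚ k)) := by
  induction k with
  | zero => simpa [recipSum, recipPairSum] using PadicGe.zero
  | succ k ih =>
    have hx := padicUnit_succ (p := p) (k := k) (by omega)
    have hx0 := hx.ne_zero
    have h1 : PadicGe p 0 (1 - (p : ℚ) / ((k : ℚ) + 1)) := by
      rw [div_eq_mul_one_div]
      exact PadicGe.one.sub ((padicGe_natCast p).int_mul hx.inv.ge)
    have h2 : PadicGe p 0 (recipPairSum ℚ k) :=
      (ReducesTo.recipPairSum (by omega)).padicGe_zero
    have h3 := (h1.int_mul (ih (by omega))).sub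
      ((padicGe_pow_self 3).mul_of_eq (h2.int_mul hx.inv.ge) (by norm_num))
    convert h3 using 1
    rw [Finset.prod_range_succ, recipSum_succ, recipPairSum_succ]
    field_simp
    ring

/-- The binomial formula for `H_{q+1}`: its last product is `±C(q+1, q+1) = 1`, so its last term is
`1/(q+1)` and cancels against the last term of `H_{q+1}`. -/
theorem recipSum_one_eq_mul_sum_prod {q : ℕ} (hq : Even q) :
    recipSum ℚ q 1 = (q + 1 : ℕ) * ∑ k ∈ Finset.range q, 1 / ((k : ℚ) + 1) ^ 2 *
      ∏ j ∈ Finset.range k, (1 - ((q + 1 : ℕ) : ℚ) / ((j : ℚ) + 1)) := by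
  have hne : ∀ j : ℕ, (j : ℚ) + 1 ≠ 0 := fun j => by positivity
  have h1 := recipSum_one_eq_sum_prod (K := ℚ) (q + 1) fun k _ => hne k
  have h2 := choose_eq_prod (K := ℚ) (q + 1) q fun k _ => hne k
  rw [recipSum_succ, Finset.sum_range_succ] at h1
  rw [hq.neg_one_pow, Nat.choose_self, Nat.cast_one, mul_one, Nat.cast_add_one,
    div_self (hne q), one_mul] at h2
  rw [Nat.cast_add_one, ← h2, pow_one, mul_one, pow_two, ← div_div, div_self (hne q),
    add_left_inj] at h1
  rw [h1, Nat.cast_add_one, Finset.mul_sum]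
  refine Finset.sum_congr rfl fun k _ => ?_
  ring

/-- `p ∑ H_{n-1}(1)/n² ≡ (3/2) H_{p-1}(2)` modulo `p³`. -/
theorem padicGe_recipDoubleSum (hq : p = q + 1) (h3 : 4 < q) :
    PadicGe p 3 (2 * (p * recipDoubleSum q) - 3 * recipSum ℚ q 2) := by
  set X := ∑ k ∈ Finset.range q, 1 / ((k : ℚ) + 1) ^ 2 * recipPairSum ℚ k with hX
  have hX1 : PadicGe p 1 X := by
    refine ReducesTo.padicGe_one ?_
    rw [← sum_recipPairSum_div_sq hq h3]
    refine ReducesTo.sum fun k hk => ?_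
    have := Finset.mem_range.1 hk
    exact (ReducesTo.inv_succ_pow (by omega) 2).mul (ReducesTo.recipPairSum (by omega))
  have h0 := recipSum_one_eq_mul_sum_prod (even_pred_prime hq (by omega))
  rw [← hq] at h0
  have h1 : PadicGe p 4 (recipSum ℚ q 1
      - p * (recipSum ℚ q 2 - p * recipDoubleSum q + p ^ 2 * X)) := by
    have e : recipSum ℚ q 1 - p * (recipSum ℚ q 2 - p * recipDoubleSum q + p ^ 2 * X)
        = p * ∑ k ∈ Finset.range q, 1 / ((k : ℚ) + 1) ^ 2 *
          (∏ j ∈ Finset.range k, (1 - (p : ℚ) / ((j : ℚ) + 1))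
            - (1 - p * recipSum ℚ k 1 + p ^ 2 * recipPairSum ℚ k)) := by
      rw [h0, ← mul_sub, hX, recipDoubleSum, recipSum, Finset.mul_sum, Finset.mul_sum,
        ← Finset.sum_sub_distrib, ← Finset.sum_add_distrib, ← Finset.sum_sub_distrib]
      congr 1
      refine Finset.sum_congr rfl fun k _ => ?_
      ring
    rw [e]
    refine padicGe_one_self.mul_of_eq (n := 3) (PadicGe.sum fun k hk => ?_) (by norm_num)
    have hk := Finset.mem_range.1 hk
    exact PadicGe.unit_mul ((padicUnit_succ (by omega)).pow 2).inv
      (padicGe_prod_one_sub hq hk.le)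
  -- The divisibility of `X` by `p` is what gains the last power here.
  have h2 : PadicGe p 4 ((p : ℚ) ^ 3 * X) := (padicGe_pow_self 3).mul_of_eq hX1 (by norm_num)
  have h4 := h1.add h2
  have h5 := (h4.add h4).sub (padicGe_two_recipSum_one_add hq h3)
  refine PadicGe.mono (PadicGe.of_pow_mul (n := 4) 1 ?_) (by norm_num)
  convert h5 using 1
  ring

/-- The convolution and stuffle identities make the difference exactly `H(1) H(2) - H(3)`, with
`H(1)` and `H(3)` both divisible by `p²`. -/
theorem padicGe_sum_recipSum_two_div (hq : p = q + 1) (h3 : 4 < q) :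
    PadicGe p 2 (∑ k ∈ Finset.range q, recipSum ℚ k 2 / ((p : ℚ) - (k + 1)) - recipDoubleSum q) := by
  have e : ∑ k ∈ Finset.range q, recipSum ℚ k 2 / ((p : ℚ) - (k + 1)) - recipDoubleSum q
      = recipSum ℚ q 1 * recipSum ℚ q 2 - recipSum ℚ q 3 := by
    have h1 := sum_recipSum_two_div_sub q
    have h2 := sum_recipSum_shuffle q
    rw [Finset.sum_add_distrib] at h1 h2
    rw [← Finset.mul_sum] at h1
    have h4 : ∀ k : ℕ, (p : ℚ) - (k + 1) = q - k := fun k => by rw [cast_prime_eq hq]; ring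
    simp only [h4, recipDoubleSum]
    linear_combination h1 + h2
  rw [e]
  exact ((padicGe_recipSum_one hq h3).mul_of_eq (padicGe_recipSum hq le_rfl 2) (by norm_num)).sub
    (padicGe_recipSum_three hq h3)

end Congruences

/-! ### Inverse central binomial sums and factorial quotients. -/

/-- The sum `∑ 1 / (k ^ 2 C(2k, k))` for `1 ≤ k ≤ N`. -/
def centralSum (N : ℕ) : ℚ :=
  ∑ k ∈ Finset.range N, 1 / (((k : ℚ) + 1) ^ 2 * (k + 1).centralBinom)

/-- The summand `(-1) ^ k (k - 1)! ^ 2 (N - k)! / (N + k)!`, with `k` shifted by one. -/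
def factorialTerm (N k : ℕ) : ℚ :=
  (-1) ^ (k + 1) * (k.factorial : ℚ) ^ 2 * (N - 1 - k).factorial / (N + 1 + k).factorial

section CentralSum

theorem centralBinom_eq_factorial (N : ℕ) :
    ((N + 1).centralBinom : ℚ) * (((N : ℚ) + 1) * N.factorial) ^ 2 = (2 * N + 2).factorial := by
  have h := Nat.add_choose_mul_factorial_mul_factorial (N + 1) (N + 1)
  rw [Nat.factorial_succ, show N + 1 + (N + 1) = 2 * (N + 1) by ring,
    ← Nat.centralBinom_eq_two_mul_choose, show 2 * (N + 1) = 2 * N + 2 by ring] at h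
  rw [← h]
  push_cast
  ring

theorem sum_factorialTerm_add (N : ℕ) :
    ∑ k ∈ Finset.range N, (factorialTerm (N + 1) k + factorialTerm N k)
      = 2 * ((-1) ^ N * (N.factorial : ℚ) ^ 2 / (((N : ℚ) + 1) * (2 * N + 1).factorial)
        - 1 / ((N : ℚ) + 1) ^ 2) := by
  -- Telescoping certificate in `k`. A sum rather than a difference of consecutive `N` occurs
  -- because the factorial sum carries the sign `(-1)^N`.
  set v : ℕ → ℚ := fun k => (-1) ^ k * (k.factorial : ℚ) ^ 2 * (N - k).factorial /
    (((N : ℚ) + 1) * (N + 1 + k).factorial) with hv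
  have h : ∀ k ∈ Finset.range N, factorialTerm (N + 1) k + factorialTerm N k
      = 2 * (v (k + 1) - v k) := by
    intro k hk
    obtain ⟨d, rfl⟩ := Nat.exists_eq_add_of_lt (Finset.mem_range.1 hk)
    simp only [hv, factorialTerm]
    rw [show k + d + 1 + 1 - 1 - k = d + 1 by omega, show k + d + 1 - 1 - k = d by omega,
      show k + d + 1 - (k + 1) = d by omega, show k + d + 1 - k = d + 1 by omega,
      show k + d + 1 + 1 + k = 2 * k + d + 2 by ring,
      show k + d + 1 + 1 + 1 + k = 2 * k + d + 2 + 1 by ring,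
      show k + d + 1 + 1 + (k + 1) = 2 * k + d + 2 + 1 by ring,
      Nat.factorial_succ (2 * k + d + 2), Nat.factorial_succ d, Nat.factorial_succ k]
    have h1 : ((2 * k + d + 2).factorial : ℚ) ≠ 0 := by exact_mod_cast Nat.factorial_ne_zero _
    push_cast
    field_simp
    ring
  rw [Finset.sum_congr rfl h, ← Finset.mul_sum, Finset.sum_range_sub]
  simp only [hv, Nat.sub_self, Nat.factorial_zero, Nat.sub_zero, add_zero, pow_zero]
  rw [show N + 1 + N = 2 * N + 1 by ring, Nat.factorial_succ N]
  have h1 : (N.factorial : ℚ) ≠ 0 := by exact_mod_cast Nat.factorial_ne_zero _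
  have h2 : ((2 * N + 1).factorial : ℚ) ≠ 0 := by exact_mod_cast Nat.factorial_ne_zero _
  push_cast
  field_simp

/-- The alternating sum of inverse squares in terms of inverse central binomial coefficients. -/
theorem altRecipSum_eq_centralSum (N : ℕ) :
    altRecipSum N 2 = 3 / 2 * centralSum N
      + 1 / 2 * (-1) ^ N * ∑ k ∈ Finset.range N, factorialTerm N k := by
  induction N with
  | zero => simp [altRecipSum, centralSum]
  | succ N ih =>
    have h := sum_factorialTerm_add N
    rw [Finset.sum_add_distrib] at h
    have hA : altRecipSum (N + 1) 2 = altRecipSum N 2 + (-1) ^ N / ((N : ℚ) + 1) ^ 2 := by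
      rw [altRecipSum, Finset.sum_range_succ]; rfl
    have hS : centralSum (N + 1) = centralSum N
        + 1 / (((N : ℚ) + 1) ^ 2 * (N + 1).centralBinom) := by
      rw [centralSum, Finset.sum_range_succ]; rfl
    have hb := centralBinom_eq_factorial N
    have hb' : ((2 * N + 2).factorial : ℚ) = (2 * N + 2) * (2 * N + 1).factorial := by
      rw [Nat.factorial_succ]; push_cast; ring
    have h1 : (N.factorial : ℚ) ≠ 0 := by exact_mod_cast Nat.factorial_ne_zero _
    have h2 : ((2 * N + 1).factorial : ℚ) ≠ 0 := by exact_mod_cast Nat.factorial_ne_zero _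
    have h3 : ((N + 1).centralBinom : ℚ) ≠ 0 := by exact_mod_cast Nat.centralBinom_ne_zero _
    have hw : factorialTerm (N + 1) N = -(-1) ^ N / (((N : ℚ) + 1) ^ 2 * (N + 1).centralBinom) := by
      rw [factorialTerm, show N + 1 - 1 - N = 0 by omega, Nat.factorial_zero,
        show N + 1 + 1 + N = 2 * N + 2 by ring, ← hb]
      push_cast
      field_simp
      ring
    have hv : (N.factorial : ℚ) ^ 2 / (((N : ℚ) + 1) * (2 * N + 1).factorial)
        = 2 / (((N : ℚ) + 1) ^ 2 * (N + 1).centralBinom) := by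
      rw [div_eq_div_iff (by positivity) (by positivity)]
      linear_combination hb + hb'
    have hs : ((-1 : ℚ) ^ N) * (-1) ^ N = 1 := by rw [← mul_pow]; simp
    rw [Finset.sum_range_succ, hA, hS, ih, hw, pow_succ]
    rw [mul_div_assoc, hv] at h
    have h4 := eq_sub_of_add_eq h
    rw [h4]
    -- With `c = 1/((N+1)² C(2N+2, N+1))`, the telescoped endpoint contributes `-2c` and the new
    -- term `k = N` contributes `c/2`; this is why the coefficient is `3/2`.
    linear_combination 3 / 2 * (1 / (((N : ℚ) + 1) ^ 2 * (N + 1).centralBinom)) * hs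

/-- With `p = q + 1`, the quotient `(q+1+k)!/(q-1-k)!` is the product of `p - 1 - k` through `p +
k`: the pairs `p ± j` for `1 ≤ j ≤ k`, together with `p` and `q - k`. -/
theorem factorialTerm_mul_prod (q k : ℕ) (hk : k < q) :
    factorialTerm q k * ∏ j ∈ Finset.range k, (1 - ((q : ℚ) + 1) ^ 2 / ((j : ℚ) + 1) ^ 2)
      = -1 / (((q : ℚ) + 1) * (q - k)) := by
  induction k with
  | zero =>
    obtain ⟨d, rfl⟩ := Nat.exists_eq_add_of_lt hk
    simp only [factorialTerm]
    rw [show 0 + d + 1 - 1 - 0 = d by omega, show 0 + d + 1 + 1 + 0 = d + 1 + 1 by omega,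
      Nat.factorial_succ, Nat.factorial_succ]
    have h1 : (d.factorial : ℚ) ≠ 0 := by exact_mod_cast Nat.factorial_ne_zero _
    push_cast
    simp
    field_simp
  | succ k ih =>
    have ih := ih (by omega)
    obtain ⟨d, rfl⟩ := Nat.exists_eq_add_of_lt hk
    have h : factorialTerm (k + 1 + d + 1) (k + 1) = factorialTerm (k + 1 + d + 1) k *
        (-((k : ℚ) + 1) ^ 2 / ((d + 1) * (2 * k + d + 4))) := by
      simp only [factorialTerm]
      rw [show k + 1 + d + 1 - 1 - (k + 1) = d by omega, show k + 1 + d + 1 - 1 - k = d + 1 by omega,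
        show k + 1 + d + 1 + 1 + (k + 1) = 2 * k + d + 3 + 1 by ring,
        show k + 1 + d + 1 + 1 + k = 2 * k + d + 3 by ring,
        Nat.factorial_succ (2 * k + d + 3), Nat.factorial_succ d, Nat.factorial_succ k]
      have h1 : ((2 * k + d + 3).factorial : ℚ) ≠ 0 := by exact_mod_cast Nat.factorial_ne_zero _
      push_cast
      field_simp
      ring
    rw [h, Finset.prod_range_succ, mul_mul_mul_comm, ih]
    push_cast
    have h1 : (k : ℚ) + 1 + d + 1 - k ≠ 0 := by ring_nf; positivity
    have h2 : (k : ℚ) + 1 + d + 1 - (k + 1) ≠ 0 := by ring_nf; positivity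
    field_simp
    ring

end CentralSum

/-! ### The inverse central binomial sum modulo `p³`. -/

section Congruences

variable {p q : ℕ} [hp : Fact p.Prime]

theorem padicGe_prod_one_sub_div_sq (hq : p = q + 1) (h3 : 2 < p) {t : ℚ} (ht : PadicGe p 2 t)
    {k : ℕ} (hk : k ≤ q) :
    PadicGe p 6 (∏ j ∈ Finset.range k, (1 - t / ((j : ℚ) + 1) ^ 2)
      - (1 - t * recipSum ℚ k 2 + t ^ 2 * ((recipSum ℚ k 2 ^ 2 - recipSum ℚ k 4) * (1 / 2)))) := by
  induction k with
  | zero => simpa [recipSum] using PadicGe.zero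
  | succ k ih =>
    have hx := (padicUnit_succ (p := p) (k := k) (by omega)).pow 2
    have hx0 : (k : ℚ) + 1 ≠ 0 := (padicUnit_succ (p := p) (k := k) (by omega)).ne_zero
    have ht0 : PadicGe p 0 t := ht.mono (by norm_num)
    have h1 : PadicGe p 0 (1 - t / ((k : ℚ) + 1) ^ 2) := by
      rw [div_eq_mul_one_div]
      exact PadicGe.one.sub (ht0.int_mul hx.inv.ge)
    have h2 : PadicGe p 0 ((recipSum ℚ k 2 ^ 2 - recipSum ℚ k 4) * (1 / 2)) :=
      (((padicGe_recipSum hq (by omega) 2).pow 2).sub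
        (padicGe_recipSum hq (by omega) 4)).int_mul (padicUnit_two h3).inv.ge
    have ht3 : PadicGe p 6 (t * t * t) :=
      (ht.mul_of_eq (k := 4) ht (by norm_num)).mul_of_eq ht (by norm_num)
    have h4 := (h1.int_mul (ih (by omega))).sub (ht3.mul_of_eq (h2.int_mul hx.inv.ge) (by norm_num))
    convert h4 using 1
    rw [Finset.prod_range_succ, recipSum_succ, recipSum_succ]
    field_simp
    ring

theorem padicGe_prod_one_sub_sq (hq : p = q + 1) (h3 : 2 < p) {k : ℕ} (hk : k ≤ q) :
    PadicGe p 4 (∏ j ∈ Finset.range k, (1 - (p : ℚ) ^ 2 / ((j : ℚ) + 1) ^ 2)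
      - (1 - p ^ 2 * recipSum ℚ k 2)) := by
  have h1 := (padicGe_prod_one_sub_div_sq hq h3 (padicGe_pow_self 2) hk).mono (n := 4) (by norm_num)
  have h2 : PadicGe p 0 ((recipSum ℚ k 2 ^ 2 - recipSum ℚ k 4) * (1 / 2)) :=
    (((padicGe_recipSum hq hk 2).pow 2).sub
      (padicGe_recipSum hq hk 4)).int_mul (padicUnit_two h3).inv.ge
  have h4 := h1.add ((padicGe_pow_self 4).mul_of_eq h2 (by norm_num))
  convert h4 using 1
  ring

theorem padicGe_inv_prod_one_sub_sq (hq : p = q + 1) (h3 : 2 < p) {k : ℕ} (hk : k ≤ q) :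
    PadicUnit p (∏ j ∈ Finset.range k, (1 - (p : ℚ) ^ 2 / ((j : ℚ) + 1) ^ 2)) ∧
    PadicGe p 4 (1 / ∏ j ∈ Finset.range k, (1 - (p : ℚ) ^ 2 / ((j : ℚ) + 1) ^ 2)
      - (1 + p ^ 2 * recipSum ℚ k 2)) := by
  have h1 := padicGe_prod_one_sub_sq hq h3 hk
  set U := ∏ j ∈ Finset.range k, (1 - (p : ℚ) ^ 2 / ((j : ℚ) + 1) ^ 2)
  set h := recipSum ℚ k 2
  have hh : PadicGe p 0 h := padicGe_recipSum hq hk 2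
  have hph : PadicGe p 2 ((p : ℚ) ^ 2 * h) := (padicGe_pow_self 2).mul_of_eq hh (by norm_num)
  have hU : PadicUnit p U := by
    have := PadicUnit.one.add_of_ge ((h1.mono (n := 1) (by norm_num)).sub (hph.mono (by norm_num)))
    convert this using 1
    ring
  refine ⟨hU, ?_⟩
  have hU0 := hU.ne_zero
  -- With `x = p² h` and `U = 1 - x + δ`, one has `1 - (1 + x) U = x² - (δ + xδ)`.
  have h4 := ((hph.mul_of_eq hph (k := 4) (by norm_num)).sub
    (h1.add (hph.mul_of_eq h1 (k := 6) (by norm_num) |>.mono (by norm_num)))).mul_of_eq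
      hU.inv.ge (k := 4) (by norm_num)
  convert h4 using 1
  field_simp
  ring

/-- `∑ 1 / (k² C(2k,k)) ≡ -H_{p-1}(2) / 6` modulo `p³`. -/
theorem padicGe_centralSum (hq : p = q + 1) (h3 : 4 < q) :
    PadicGe p 3 (6 * centralSum q + recipSum ℚ q 2) := by
  have hexact := altRecipSum_eq_centralSum q
  rw [(even_pred_prime hq (by omega)).neg_one_pow, mul_one] at hexact
  set D := ∑ k ∈ Finset.range q, recipSum ℚ k 2 / ((p : ℚ) - (k + 1)) with hD
  set W := ∑ k ∈ Finset.range q, factorialTerm q k with hW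
  have h1 : PadicGe p 4 (p * W + recipSum ℚ q 1 + p ^ 2 * D) := by
    have e : p * W + recipSum ℚ q 1 + p ^ 2 * D = ∑ k ∈ Finset.range q,
        (p * factorialTerm q k + 1 / ((p : ℚ) - (k + 1)) ^ 1
          + p ^ 2 * (recipSum ℚ k 2 / ((p : ℚ) - (k + 1)))) := by
      rw [Finset.sum_add_distrib, Finset.sum_add_distrib, ← recipSum_reflect hq, ← Finset.mul_sum,
        ← Finset.mul_sum]
    rw [e]
    refine PadicGe.sum fun k hk => ?_
    have hk := Finset.mem_range.1 hk
    obtain ⟨hU, h2⟩ := padicGe_inv_prod_one_sub_sq hq (by omega) hk.le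
    have hy := padicUnit_sub_succ (p := p) (k := k) (by omega)
    have h4 := factorialTerm_mul_prod q k hk
    rw [← cast_prime_eq hq] at h4
    have h5 : (q : ℚ) - k = p - (k + 1) := by rw [cast_prime_eq hq]; ring
    rw [h5, ← eq_div_iff hU.ne_zero] at h4
    have hy0 := hy.ne_zero
    have hU0 := hU.ne_zero
    have hp0 : (p : ℚ) ≠ 0 := by exact_mod_cast hp.out.ne_zero
    have h6 := (hy.inv.ge.int_mul h2).neg
    convert h6 using 1
    rw [h4]
    field_simp
    ring
  have hD2 := padicGe_sum_recipSum_two_div hq h3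
  rw [← hD] at hD2
  have hD4 : PadicGe p 4 ((p : ℚ) ^ 2 * (D - recipDoubleSum q)) :=
    (padicGe_pow_self 2).mul_of_eq hD2 (by norm_num)
  have hb : PadicGe p 4 (p * (2 * (p * recipDoubleSum q) - 3 * recipSum ℚ q 2)) :=
    padicGe_one_self.mul_of_eq (padicGe_recipDoubleSum hq h3) (by norm_num)
  have hA : PadicGe p 4 (p * (4 * altRecipSum q 2 + 3 * recipSum ℚ q 2)) :=
    padicGe_one_self.mul_of_eq (padicGe_altRecipSum_two hq h3) (by norm_num)
  have hH := padicGe_two_recipSum_one_add hq h3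
  refine PadicGe.mono (PadicGe.of_pow_mul (n := 4) 1 ?_) (by norm_num)
  -- In this combination `D`, the double sum and `H(1)` cancel, leaving `p (4A - 2W + H(2))` with
  -- `A` the alternating sum; the exact identity turns it into `p` times the claim.
  have h7 := ((((hA.sub (h1.add h1)).add (hD4.add hD4)).add hb).add hH)
  convert h7 using 1
  rw [hexact]
  ring

end Congruences

/-! ### The Bailey–Borwein–Bradley sum by Wilf–Zeilberger telescoping. -/

section Telescoping

/-- The numerator `∏_{m ≤ n} (m ^ 2 - 4 t) / C(2n, n)`. -/
def wzCoeff (t : ℚ) (n : ℕ) : ℚ :=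
  (∏ m ∈ Finset.range n, (((m : ℚ) + 1) ^ 2 - 4 * t)) / n.centralBinom

/-- The product `∏_{1 ≤ i ≤ n} 1 / ((k + i) ^ 2 - t)`. -/
def wzProd (t : ℚ) (n k : ℕ) : ℚ := ∏ i ∈ Finset.range n, 1 / (((k : ℚ) + i + 1) ^ 2 - t)

/-- The companion of `wzCoeff t n * wzProd t (n + 1) k` in a Wilf–Zeilberger pair. -/
def wzMate (t : ℚ) (n k : ℕ) : ℚ :=
  wzCoeff t n / (2 * n + 1) * (k + 3 * (n + 1) / 2) * wzProd t (n + 1) k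

/-- The summand of the Bailey–Borwein–Bradley series, with `k` shifted by one. -/
def bbbTerm (t : ℚ) (k : ℕ) : ℚ :=
  1 / ((k + 1).centralBinom * (((k : ℚ) + 1) ^ 2 - t)) *
    ∏ m ∈ Finset.range k, ((((m : ℚ) + 1) ^ 2 - 4 * t) / (((m : ℚ) + 1) ^ 2 - t))

theorem centralBinom_succ_cast (n : ℕ) :
    ((n + 1).centralBinom : ℚ) = 2 * (2 * n + 1) * n.centralBinom / (n + 1) := by
  have h := Nat.succ_mul_centralBinom_succ n
  have h' := congrArg (Nat.cast : ℕ → ℚ) h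
  push_cast at h'
  rw [eq_div_iff (by positivity)]
  linear_combination h'

theorem wz_pair {t : ℚ} (ht : ∀ i : ℕ, ((i : ℚ) + 1) ^ 2 - t ≠ 0) (n k : ℕ) :
    wzCoeff t (n + 1) * wzProd t (n + 2) k - wzCoeff t n * wzProd t (n + 1) k
      = wzMate t n (k + 1) - wzMate t n k := by
  set π := ∏ i ∈ Finset.range n, 1 / (((k : ℚ) + i + 2) ^ 2 - t) with hπ
  have e1 : wzProd t (n + 1) k = π * (1 / (((k : ℚ) + 1) ^ 2 - t)) := by
    rw [wzProd, Finset.prod_range_succ', hπ]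
    push_cast
    rw [add_zero]
    congr 1
    refine Finset.prod_congr rfl fun i _ => ?_
    ring
  have e2 : wzProd t (n + 1) (k + 1) = π * (1 / (((k : ℚ) + n + 2) ^ 2 - t)) := by
    rw [wzProd, Finset.prod_range_succ, hπ]
    push_cast
    congr 1
    · refine Finset.prod_congr rfl fun i _ => ?_
      ring
    · ring
  have e3 : wzProd t (n + 2) k
      = π * (1 / (((k : ℚ) + 1) ^ 2 - t)) * (1 / (((k : ℚ) + n + 2) ^ 2 - t)) := by
    rw [← e1, wzProd, Finset.prod_range_succ, ← wzProd]
    push_cast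
    ring
  have e4 : wzCoeff t (n + 1)
      = wzCoeff t n * ((((n : ℚ) + 1) ^ 2 - 4 * t) * (n + 1) / (2 * (2 * n + 1))) := by
    have h0 : (n.centralBinom : ℚ) ≠ 0 := by exact_mod_cast Nat.centralBinom_ne_zero _
    rw [wzCoeff, wzCoeff, Finset.prod_range_succ, centralBinom_succ_cast]
    field_simp
  have h1 := ht k
  have h2 : ((k : ℚ) + n + 2) ^ 2 - t ≠ 0 := by
    have := ht (k + n + 1)
    push_cast at this
    convert this using 2
    ring
  rw [wzMate, wzMate, e1, e2, e3, e4]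
  push_cast
  field_simp
  ring

theorem wzMate_zero (t : ℚ) (n : ℕ) : wzMate t n 0 = 3 * bbbTerm t n := by
  have h0 : (n.centralBinom : ℚ) ≠ 0 := by exact_mod_cast Nat.centralBinom_ne_zero _
  rw [wzMate, bbbTerm, wzCoeff, wzProd, Finset.prod_range_succ, Finset.prod_div_distrib,
    Finset.prod_div_distrib, centralBinom_succ_cast]
  simp only [Nat.cast_zero, zero_add, Finset.prod_const_one]
  field_simp

theorem wzCoeff_zero_of_lt {t : ℚ} {n : ℕ} (ht : 4 * t = ((n : ℚ) + 1) ^ 2) :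
    wzCoeff t (n + 1) = 0 := by
  rw [wzCoeff, Finset.prod_range_succ, ht, sub_self, mul_zero, zero_div]

/-- Summing the pair relation over `n` telescopes: the upper end vanishes since `4t = (q+1)²`, and
only the `n = 0` term remains. -/
theorem sum_wzMate_sub {t : ℚ} (ht : ∀ i : ℕ, ((i : ℚ) + 1) ^ 2 - t ≠ 0) {q : ℕ}
    (hq : 4 * t = ((q : ℚ) + 1) ^ 2) (k : ℕ) :
    ∑ n ∈ Finset.range (q + 1), wzMate t n (k + 1) - ∑ n ∈ Finset.range (q + 1), wzMate t n k
      = -(1 / (((k : ℚ) + 1) ^ 2 - t)) := by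
  rw [← Finset.sum_sub_distrib, Finset.sum_congr rfl fun n _ => (wz_pair ht n k).symm,
    Finset.sum_range_sub (fun n => wzCoeff t n * wzProd t (n + 1) k), wzCoeff_zero_of_lt hq]
  simp [wzCoeff, wzProd]

open Filter Topology

theorem tendsto_natCast_add_atTop (a : ℚ) :
    Tendsto (fun k : ℕ => (k : ℚ) + a) atTop atTop :=
  tendsto_atTop_add_const_right _ _ tendsto_natCast_atTop_atTop

theorem tendsto_one_div_sq_sub (a t : ℚ) :
    Tendsto (fun k : ℕ => 1 / (((k : ℚ) + a) ^ 2 - t)) atTop (𝓝 0) := by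
  simp only [one_div]
  refine tendsto_inv_atTop_zero.comp ?_
  have h := (tendsto_pow_atTop (two_ne_zero)).comp (tendsto_natCast_add_atTop a)
  exact (tendsto_atTop_add_const_right _ (-t) h).congr fun k => (sub_eq_add_neg _ _).symm

theorem tendsto_one_div_natCast_add (a : ℚ) :
    Tendsto (fun k : ℕ => 1 / ((k : ℚ) + a)) atTop (𝓝 0) := by
  simp only [one_div]
  exact tendsto_inv_atTop_zero.comp (tendsto_natCast_add_atTop a)

theorem tendsto_linear_div_sq_sub (b t : ℚ) :
    Tendsto (fun k : ℕ => ((k : ℚ) + b) * (1 / (((k : ℚ) + 1) ^ 2 - t))) atTop (𝓝 0) := by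
  have h1 : Tendsto (fun k : ℕ => 1 / ((k : ℚ) + 1) + (b - 1) * (1 / ((k : ℚ) + 1)) ^ 2)
      atTop (𝓝 (0 + (b - 1) * 0 ^ 2)) :=
    (tendsto_one_div_natCast_add 1).add (((tendsto_one_div_natCast_add 1).pow 2).const_mul _)
  have h2 : Tendsto (fun k : ℕ => 1 - t * (1 / ((k : ℚ) + 1)) ^ 2) atTop (𝓝 (1 - t * 0 ^ 2)) :=
    tendsto_const_nhds.sub (((tendsto_one_div_natCast_add 1).pow 2).const_mul _)
  have h3 := h1.div h2 (by norm_num)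
  have h4 : (0 + (b - 1) * 0 ^ 2) / (1 - t * 0 ^ 2) = 0 := by norm_num
  rw [h4] at h3
  refine h3.congr fun k => ?_
  have hk : (k : ℚ) + 1 ≠ 0 := by positivity
  have e : 1 - t * (1 / ((k : ℚ) + 1)) ^ 2 = (((k : ℚ) + 1) ^ 2 - t) / ((k : ℚ) + 1) ^ 2 := by
    field_simp
  simp only [Pi.div_apply]
  rw [e, div_div_eq_mul_div, mul_one_div]
  congr 1
  field_simp
  ring

theorem tendsto_wzMate (t : ℚ) (n : ℕ) : Tendsto (fun k => wzMate t n k) atTop (𝓝 0) := by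
  have h1 : ∀ k : ℕ, wzMate t n k = wzCoeff t n / (2 * n + 1) *
      ((((k : ℚ) + 3 * (n + 1) / 2) * (1 / (((k : ℚ) + 1) ^ 2 - t))) *
        ∏ i ∈ Finset.range n, 1 / (((k : ℚ) + (i + 2)) ^ 2 - t)) := by
    intro k
    rw [wzMate, wzProd, Finset.prod_range_succ']
    push_cast
    rw [add_zero]
    have : ∀ i : ℕ, (k : ℚ) + (i + 1) + 1 = k + (i + 2) := fun i => by ring
    simp only [this]
    ring
  simp only [h1]
  have h2 : Tendsto (fun k : ℕ => ∏ i ∈ Finset.range n, 1 / (((k : ℚ) + ((i : ℚ) + 2)) ^ 2 - t))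
      atTop (𝓝 (∏ _i ∈ Finset.range n, (0 : ℚ))) :=
    tendsto_finsetProd _ fun i _ => tendsto_one_div_sq_sub _ t
  have h3 := ((tendsto_linear_div_sq_sub (3 * (n + 1) / 2) t).mul h2).const_mul
    (wzCoeff t n / (2 * n + 1))
  simpa using h3

theorem two_mul_succ_ne_odd {q : ℕ} (hq : Even q) (i : ℤ) : (i : ℚ) ≠ ((q : ℚ) + 1) / 2 := by
  intro h
  have h1 : ((2 * i : ℤ) : ℚ) = ((q + 1 : ℤ) : ℚ) := by push_cast; linarith
  have h2 := Int.cast_injective h1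
  obtain ⟨r, rfl⟩ := hq
  omega

/-- The Bailey–Borwein–Bradley sum terminates when `t = (p / 2) ^ 2`. -/
theorem sum_bbbTerm {q : ℕ} (hq : Even q) :
    3 * ∑ k ∈ Finset.range (q + 1), bbbTerm (((q : ℚ) + 1) ^ 2 / 4) k = 2 / ((q : ℚ) + 1) ^ 2 := by
  set t := ((q : ℚ) + 1) ^ 2 / 4 with htd
  have h4 : 4 * t = ((q : ℚ) + 1) ^ 2 := by rw [htd]; ring
  -- `q + 1` is odd, so `√t = (q+1)/2` is a half-integer and no denominator vanishes.
  have hm : ∀ i : ℕ, (i : ℚ) + 1 - ((q : ℚ) + 1) / 2 ≠ 0 := fun i h =>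
    two_mul_succ_ne_odd hq (i + 1) (by push_cast; linarith)
  have hpl : ∀ i : ℕ, (i : ℚ) + 1 + ((q : ℚ) + 1) / 2 ≠ 0 := fun i => by positivity
  have hf : ∀ i : ℕ, ((i : ℚ) + 1) ^ 2 - t
      = ((i : ℚ) + 1 - ((q : ℚ) + 1) / 2) * ((i : ℚ) + 1 + ((q : ℚ) + 1) / 2) := fun i => by
    rw [htd]; ring
  have ht : ∀ i : ℕ, ((i : ℚ) + 1) ^ 2 - t ≠ 0 := fun i => by
    rw [hf]; exact mul_ne_zero (hm i) (hpl i)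
  set g : ℕ → ℚ := fun k => ∑ n ∈ Finset.range (q + 1), wzMate t n k with hg
  -- Closed form of the tail `∑_{j > k} 1/(j² - t)`: partial fractions at `±(q+1)/2` telescope with
  -- step `q + 1`. Thus `g` and `h` have equal increments, and both tend to 0.
  set h : ℕ → ℚ := fun k => 1 / ((q : ℚ) + 1) *
    ∑ i ∈ Finset.range (q + 1), 1 / ((k : ℚ) + (i + 1 - ((q : ℚ) + 1) / 2)) with hh
  have hstep : ∀ k, g (k + 1) - h (k + 1) = g k - h k := by
    intro k
    have h1 : g (k + 1) - g k = -(1 / (((k : ℚ) + 1) ^ 2 - t)) := sum_wzMate_sub ht h4 k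
    have h2 : h (k + 1) - h k = -(1 / (((k : ℚ) + 1) ^ 2 - t)) := by
      simp only [hh]
      rw [← mul_sub, ← Finset.sum_sub_distrib]
      let f : ℕ → ℚ := fun i => 1 / ((k : ℚ) + ((i : ℚ) + 1 - ((q : ℚ) + 1) / 2))
      have e : ∀ i ∈ Finset.range (q + 1), 1 / (((k + 1 : ℕ) : ℚ) + ((i : ℚ) + 1 - ((q : ℚ) + 1) / 2))
          - 1 / ((k : ℚ) + ((i : ℚ) + 1 - ((q : ℚ) + 1) / 2)) = f (i + 1) - f i := by
        intro i _
        simp only [f]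
        push_cast
        congr 2
        ring
      rw [Finset.sum_congr rfl e, Finset.sum_range_sub f, hf]
      simp only [f]
      have e1 : (k : ℚ) + (((q + 1 : ℕ) : ℚ) + 1 - ((q : ℚ) + 1) / 2)
          = (k : ℚ) + 1 + ((q : ℚ) + 1) / 2 := by push_cast; ring
      have e2 : (k : ℚ) + (((0 : ℕ) : ℚ) + 1 - ((q : ℚ) + 1) / 2)
          = (k : ℚ) + 1 - ((q : ℚ) + 1) / 2 := by push_cast; ring
      rw [e1, e2, div_sub_div _ _ (hpl k) (hm k)]
      have hp := hpl k
      have hm := hm k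
      have hq1 : (q : ℚ) + 1 ≠ 0 := by positivity
      rw [div_mul_div_comm, ← neg_div, div_eq_div_iff (mul_ne_zero hq1 (mul_ne_zero hp hm))
        (mul_ne_zero hm hp)]
      ring
    linarith
  have hconst : ∀ k, g k - h k = g 0 - h 0 := by
    intro k
    induction k with
    | zero => rfl
    | succ k ih => rw [hstep, ih]
  have hlim : Tendsto (fun k => g k - h k) atTop (𝓝 0) := by
    have h1 : Tendsto g atTop (𝓝 (∑ _n ∈ Finset.range (q + 1), (0 : ℚ))) :=
      tendsto_finsetSum _ fun n _ => tendsto_wzMate t n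
    have h2 : Tendsto h atTop (𝓝 (1 / ((q : ℚ) + 1) * ∑ _n ∈ Finset.range (q + 1), (0 : ℚ))) :=
      (tendsto_finsetSum _ fun n _ => tendsto_one_div_natCast_add _).const_mul _
    simpa using h1.sub h2
  have h0 : g 0 - h 0 = 0 := by
    refine tendsto_nhds_unique ?_ hlim
    simp only [hconst]
    exact tendsto_const_nhds
  have hg0 : g 0 = 3 * ∑ k ∈ Finset.range (q + 1), bbbTerm t k := by
    simp only [hg, wzMate_zero, Finset.mul_sum]
  have hh0 : h 0 = 2 / ((q : ℚ) + 1) ^ 2 := by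
    simp only [hh, Nat.cast_zero, zero_add]
    -- Reflection about `(q+1)/2` is odd on these terms, so only `i = q` contributes to `h 0`.
    have hz : ∑ i ∈ Finset.range q, 1 / ((i : ℚ) + 1 - ((q : ℚ) + 1) / 2) = 0 := by
      have h1 := sum_range_reflect_succ (fun x : ℚ => 1 / (x - ((q : ℚ) + 1) / 2)) q
      have h2 : ∀ i : ℕ, 1 / ((q : ℚ) + 1 - ((i : ℚ) + 1) - ((q : ℚ) + 1) / 2)
          = -(1 / ((i : ℚ) + 1 - ((q : ℚ) + 1) / 2)) := by
        intro i
        rw [← one_div_neg_eq_neg_one_div]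
        congr 1
        ring
      simp only [h2, Finset.sum_neg_distrib] at h1
      linarith
    rw [Finset.sum_range_succ, hz]
    field_simp
    ring
  rw [← hg0, ← hh0]
  linarith

end Telescoping

/-! ### Expansion in `t` and comparison modulo `p³`. -/

section Final

variable {p q : ℕ} [hp : Fact p.Prime]

theorem prod_one_add_div_eq_choose (n k : ℕ) :
    ∏ m ∈ Finset.range k, (1 + (n : ℚ) / ((m : ℚ) + 1)) = (n + k).choose k := by
  induction k with
  | zero => simp
  | succ k ih =>
    have h := congrArg (Nat.cast : ℕ → ℚ) (Nat.add_one_mul_choose_eq (n + k) k)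
    push_cast at h
    rw [Finset.prod_range_succ, ih, ← add_assoc]
    have hk : (k : ℚ) + 1 ≠ 0 := by positivity
    field_simp
    linear_combination h

/-- Factor as `(1 - n/m)(1 + n/m)` with `n = q + 1`: the first product is `C(n, n) = 1`, the second
is `C(2n-1, n-1)`, half the central coefficient. -/
theorem prod_one_sub_sq_eq_centralBinom {q : ℕ} (hq : Even q) :
    ∏ m ∈ Finset.range q, (1 - ((q : ℚ) + 1) ^ 2 / ((m : ℚ) + 1) ^ 2)
      = ((q + 1).centralBinom : ℚ) / 2 := by
  have h1 := choose_eq_prod (K := ℚ) (q + 1) q fun j _ => by positivity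
  have h2 := prod_one_add_div_eq_choose (q + 1) q
  have hq1 : (q : ℚ) + 1 ≠ 0 := by positivity
  rw [hq.neg_one_pow, Nat.choose_self, Nat.cast_one, mul_one, Nat.cast_add_one, div_self hq1,
    one_mul] at h1
  have h3 : (q + 1).centralBinom = 2 * (q + 1 + q).choose q := by
    rw [Nat.centralBinom_eq_two_mul_choose, show 2 * (q + 1) = 2 * q + 1 + 1 by ring,
      Nat.choose_succ_succ, Nat.choose_symm_half, show q + 1 + q = 2 * q + 1 by ring]
    ring
  have h4 : ∏ m ∈ Finset.range q, (1 - ((q : ℚ) + 1) ^ 2 / ((m : ℚ) + 1) ^ 2)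
      = (∏ m ∈ Finset.range q, (1 - ((q : ℚ) + 1) / ((m : ℚ) + 1)))
        * ∏ m ∈ Finset.range q, (1 + ((q + 1 : ℕ) : ℚ) / ((m : ℚ) + 1)) := by
    rw [← Finset.prod_mul_distrib]
    refine Finset.prod_congr rfl fun m _ => ?_
    rw [Nat.cast_add_one, ← div_pow]
    ring
  rw [h4, ← h1, one_mul, h2, h3, Nat.cast_mul, Nat.cast_ofNat,
    mul_div_cancel_left₀ _ two_ne_zero]

theorem bbbTerm_last {q : ℕ} (hq : Even q) :
    bbbTerm (((q : ℚ) + 1) ^ 2 / 4) q = 2 / (3 * ((q : ℚ) + 1) ^ 2) /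
      ∏ m ∈ Finset.range q, (1 - ((q : ℚ) + 1) ^ 2 / 4 / ((m : ℚ) + 1) ^ 2) := by
  have h0 : ((q + 1).centralBinom : ℚ) ≠ 0 := by exact_mod_cast Nat.centralBinom_ne_zero _
  have h1 : ∀ m ∈ Finset.range q, (((m : ℚ) + 1) ^ 2 - 4 * (((q : ℚ) + 1) ^ 2 / 4)) /
      (((m : ℚ) + 1) ^ 2 - ((q : ℚ) + 1) ^ 2 / 4)
      = (1 - ((q : ℚ) + 1) ^ 2 / ((m : ℚ) + 1) ^ 2) /
        (1 - ((q : ℚ) + 1) ^ 2 / 4 / ((m : ℚ) + 1) ^ 2) := by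
    intro m _
    have hm : ((m : ℚ) + 1) ^ 2 ≠ 0 := by positivity
    rw [← mul_div_mul_left (1 - ((q : ℚ) + 1) ^ 2 / ((m : ℚ) + 1) ^ 2) _ hm, mul_sub, mul_sub,
      mul_div_cancel₀ _ hm, mul_div_cancel₀ _ hm]
    ring
  rw [bbbTerm, Finset.prod_congr rfl h1, Finset.prod_div_distrib,
    prod_one_sub_sq_eq_centralBinom hq]
  have hq1 : (q : ℚ) + 1 ≠ 0 := by positivity
  have e : ((q : ℚ) + 1) ^ 2 - ((q : ℚ) + 1) ^ 2 / 4 = 3 * ((q : ℚ) + 1) ^ 2 / 4 := by ring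
  rw [e, mul_div_assoc']
  congr 1
  field_simp
  norm_num

theorem padicGe_quarter_sq (h : 2 < p) : PadicGe p 2 ((p : ℚ) ^ 2 / 4) := by
  have h1 := ((padicUnit_two h).mul (padicUnit_two h)).inv.ge
  have := (padicGe_pow_self (p := p) 2).mul_of_eq h1 (k := 2) (by norm_num)
  convert this using 1
  norm_num
  ring

/-- The Bailey–Borwein–Bradley sum at `t = (p / 2) ^ 2` is `-H_{p-1}(2) / 6` modulo `p³`. -/
theorem padicGe_sum_bbbTerm (hq : p = q + 1) (h3 : 4 < q) :
    PadicGe p 3 (6 * ∑ k ∈ Finset.range q, bbbTerm ((p : ℚ) ^ 2 / 4) k + recipSum ℚ q 2) := by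
  have heven := even_pred_prime hq (by omega)
  have hexact := sum_bbbTerm heven
  rw [Finset.sum_range_succ, bbbTerm_last heven, ← cast_prime_eq hq] at hexact
  have ht := padicGe_quarter_sq (p := p) (by omega)
  have hexp := padicGe_prod_one_sub_div_sq hq (by omega) ht le_rfl
  set t := (p : ℚ) ^ 2 / 4 with htd
  set Q := ∏ j ∈ Finset.range q, (1 - t / ((j : ℚ) + 1) ^ 2)
  set f := ∑ k ∈ Finset.range q, bbbTerm t k
  have hH2 : PadicGe p 1 (recipSum ℚ q 2) := padicGe_recipSum_one_of_lt hq (by omega) (by omega)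
  have hH4 : PadicGe p 1 (recipSum ℚ q 4) := padicGe_recipSum_one_of_lt hq (by omega) h3
  have hth : PadicGe p 3 (t * recipSum ℚ q 2) := ht.mul_of_eq hH2 (by norm_num)
  have htt : PadicGe p 5 (t * t * ((recipSum ℚ q 2 * recipSum ℚ q 2 - recipSum ℚ q 4) * (1 / 2))) :=
    (ht.mul_of_eq ht (k := 4) (by norm_num)).mul_of_eq (n := 1)
      ((((hH2.mul_of_eq hH2 (k := 2) (by norm_num)).mono (by norm_num)).sub hH4).mul_of_eq
        (padicUnit_two (by omega)).inv.ge (by norm_num)) (by norm_num)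
  have hQ : PadicGe p 5 (Q - 1 + t * recipSum ℚ q 2) := by
    have := (hexp.mono (n := 5) (by norm_num)).add htt
    convert this using 1
    ring
  have hQ1 : PadicGe p 3 (Q - 1) := by
    have := (hQ.mono (n := 3) (by norm_num)).sub hth
    rwa [add_sub_cancel_right] at this
  have hQu : PadicUnit p Q := by
    have := PadicUnit.one.add_of_ge (hQ1.mono (n := 1) (by norm_num))
    rwa [add_sub_cancel] at this
  have hp0 : (p : ℚ) ≠ 0 := by exact_mod_cast hp.out.ne_zero
  have hQ0 := hQu.ne_zero
  -- Here `6f = (4/p²)(1 - 1/Q)`, and `4t = p²` matches the linear term of `Q`; every term on the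
  -- right has valuation at least 5.
  have key : p ^ 2 * (Q * (6 * f + recipSum ℚ q 2))
      = 2 * (Q - 1 + t * recipSum ℚ q 2) + 2 * (Q - 1 + t * recipSum ℚ q 2)
        + p ^ 2 * (recipSum ℚ q 2 * (Q - 1)) := by
    have h1 : f = 2 / (3 * (p : ℚ) ^ 2) - 2 / (3 * (p : ℚ) ^ 2) / Q := by
      have e : 2 / (3 * (p : ℚ) ^ 2) = 2 / (p : ℚ) ^ 2 / 3 := by field_simp
      linear_combination hexact / 3 - e
    rw [h1, htd]
    field_simp
    ring
  refine PadicGe.of_mul_unit hQu (PadicGe.mono (PadicGe.of_pow_mul (n := 5) 2 ?_) (by norm_num))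
  rw [key]
  have h2 := ((padicUnit_two (p := p) (by omega)).ge).int_mul hQ
  exact (h2.add h2).add (((padicGe_pow_self 2).mul_of_eq (k := 6)
    (hH2.mul_of_eq hQ1 (k := 4) (by norm_num)) (by norm_num)).mono (by norm_num))

/-- As `2k < p²`, a binomial coefficient `C(2k, k)` contains at most one factor `p`. -/
theorem padicGe_inv_centralBinom {k : ℕ} (h2 : 2 < p) (hk : k < p) :
    PadicGe p (-1) (1 / (k.centralBinom : ℚ)) := by
  have h0 : (k.centralBinom : ℚ) ≠ 0 := by exact_mod_cast Nat.centralBinom_ne_zero _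
  have h1 : padicValNat p k.centralBinom ≤ 1 := by
    rw [← Nat.factorization_def _ hp.out, Nat.centralBinom_eq_two_mul_choose]
    exact Nat.factorization_choose_le_one (by nlinarith)
  have hp1 : (1 : ℚ) ≤ p := by exact_mod_cast hp.out.one_lt.le
  unfold PadicGe
  rw [padicNorm.div, padicNorm.one, padicNorm.eq_zpow_of_nonzero h0, one_div, ← zpow_neg, neg_neg,
    padicValRat.of_nat]
  exact zpow_le_zpow_right₀ hp1 (by omega)

theorem padicUnit_sq_sub {t : ℚ} (ht : PadicGe p 2 t) {k : ℕ} (hk : k + 1 < p) :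
    PadicUnit p (((k : ℚ) + 1) ^ 2 - t) :=
  ((padicUnit_succ hk).pow 2).sub_of_ge (ht.mono (by norm_num))

theorem padicGe_natCast_mul (n : ℕ) {m : ℤ} {x : ℚ} (hx : PadicGe p m x) :
    PadicGe p m ((n : ℚ) * x) := (padicGe_natCast n).int_mul hx

theorem padicGe_prod_ratio (hq : p = q + 1) {t : ℚ} (ht : PadicGe p 2 t) {k : ℕ} (hk : k ≤ q) :
    PadicGe p 4 (∏ m ∈ Finset.range k, ((((m : ℚ) + 1) ^ 2 - 4 * t) / (((m : ℚ) + 1) ^ 2 - t))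
      - (1 - 3 * t * recipSum ℚ k 2)) := by
  induction k with
  | zero => simpa [recipSum] using PadicGe.zero
  | succ k ih =>
    have hx := (padicUnit_succ (p := p) (k := k) (by omega)).pow 2
    have hx0 : (k : ℚ) + 1 ≠ 0 := (padicUnit_succ (p := p) (k := k) (by omega)).ne_zero
    have hy := padicUnit_sq_sub ht (k := k) (by omega)
    have hy0 := hy.ne_zero
    have htt : PadicGe p 4 (t * t) := ht.mul_of_eq ht (by norm_num)
    have h1 : PadicGe p 0 ((((k : ℚ) + 1) ^ 2 - 4 * t) / (((k : ℚ) + 1) ^ 2 - t)) := by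
      rw [div_eq_mul_one_div]
      exact (hx.ge.sub ((padicGe_natCast_mul 4 ht).mono (by norm_num))).int_mul hy.inv.ge
    have h2 : PadicGe p 0 (((9 : ℕ) : ℚ) * recipSum ℚ k 2
        - ((3 : ℕ) : ℚ) * (1 / ((k : ℚ) + 1) ^ 2)) :=
      (padicGe_natCast_mul 9 (padicGe_recipSum hq (by omega) 2)).sub
        (padicGe_natCast_mul 3 hx.inv.ge)
    have h4 := (h1.int_mul (ih (by omega))).add
      (htt.mul_of_eq (h2.int_mul hy.inv.ge) (k := 4) (by norm_num))
    convert h4 using 1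
    rw [Finset.prod_range_succ, recipSum_succ]
    push_cast
    field_simp
    ring

/-- Each factor `(m² - 4t)/(m² - t)` is `1 - 3t/m²` to first order, whence the coefficient 3. The
error has valuation at least 4, and dividing by the central binomial coefficient lowers this to 3.
-/
theorem padicGe_bbbTerm_sub (hq : p = q + 1) (h2 : 2 < p) {t : ℚ} (ht : PadicGe p 2 t) {k : ℕ}
    (hk : k < q) :
    PadicGe p 3 (bbbTerm t k - 1 / (((k : ℚ) + 1) ^ 2 * (k + 1).centralBinom)
      - t * (1 / (((k : ℚ) + 1) ^ 4 * (k + 1).centralBinom)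
        - 3 * (recipSum ℚ k 2 / (((k : ℚ) + 1) ^ 2 * (k + 1).centralBinom)))) := by
  have hx := (padicUnit_succ (p := p) (k := k) (by omega)).pow 2
  have hx0 : (k : ℚ) + 1 ≠ 0 := (padicUnit_succ (p := p) (k := k) (by omega)).ne_zero
  have hy := padicUnit_sq_sub ht (k := k) (by omega)
  have hy0 := hy.ne_zero
  have htt : PadicGe p 4 (t * t) := ht.mul_of_eq ht (by norm_num)
  have hR := padicGe_prod_ratio hq ht hk.le
  have hc := padicGe_inv_centralBinom (k := k + 1) h2 (by omega)
  have hc0 : ((k + 1).centralBinom : ℚ) ≠ 0 := by exact_mod_cast Nat.centralBinom_ne_zero _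
  rw [bbbTerm]
  set R := ∏ m ∈ Finset.range k, ((((m : ℚ) + 1) ^ 2 - 4 * t) / (((m : ℚ) + 1) ^ 2 - t))
  have h5 : PadicGe p 0 (1 / ((k : ℚ) + 1) ^ 2 * (1 / ((k : ℚ) + 1) ^ 2)
      - ((3 : ℕ) : ℚ) * (recipSum ℚ k 2 * (1 / ((k : ℚ) + 1) ^ 2))) :=
    (hx.inv.ge.int_mul hx.inv.ge).sub
      (padicGe_natCast_mul 3 ((padicGe_recipSum hq hk.le 2).int_mul hx.inv.ge))
  have h6 := hc.mul_of_eq (k := 3) ((hy.inv.ge.int_mul hR).add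
    (htt.mul_of_eq (h5.int_mul hy.inv.ge) (k := 4) (by norm_num))) (by norm_num)
  convert h6 using 1
  push_cast
  field_simp
  ring

theorem padicGe_combination (hq : p = q + 1) (h3 : 4 < q) :
    PadicGe p 1 (∑ k ∈ Finset.range q, 1 / (((k : ℚ) + 1) ^ 4 * (k + 1).centralBinom)
      - 3 * ∑ k ∈ Finset.range q,
        recipSum ℚ k 2 / (((k : ℚ) + 1) ^ 2 * (k + 1).centralBinom)) := by
  have h1 : PadicGe p 3 (∑ k ∈ Finset.range q, (bbbTerm ((p : ℚ) ^ 2 / 4) k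
      - 1 / (((k : ℚ) + 1) ^ 2 * (k + 1).centralBinom)
      - (p : ℚ) ^ 2 / 4 * (1 / (((k : ℚ) + 1) ^ 4 * (k + 1).centralBinom)
        - 3 * (recipSum ℚ k 2 / (((k : ℚ) + 1) ^ 2 * (k + 1).centralBinom))))) :=
    PadicGe.sum fun k hk => padicGe_bbbTerm_sub hq (by omega) (padicGe_quarter_sq (by omega))
      (Finset.mem_range.1 hk)
  rw [Finset.sum_sub_distrib, Finset.sum_sub_distrib, ← Finset.mul_sum, Finset.sum_sub_distrib,
    ← Finset.mul_sum] at h1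
  have h2 := (padicGe_sum_bbbTerm hq h3).sub (padicGe_centralSum hq h3)
  have h6 : PadicUnit p ((6 : ℕ) : ℚ) := by
    refine padicUnit_natCast fun hd => ?_
    have := Nat.le_of_dvd (by omega) hd
    have h6 : p = 6 := by omega
    exact absurd hp.out (by rw [h6]; norm_num)
  have h4 : PadicGe p 3 (∑ k ∈ Finset.range q, bbbTerm ((p : ℚ) ^ 2 / 4) k - centralSum q) := by
    refine PadicGe.of_mul_unit h6 ?_
    convert h2 using 1
    push_cast
    ring
  have h5 := padicGe_natCast_mul 4 (h4.sub h1)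
  -- Four times the difference of `h4` and `h1` is `p²` times the target, as `4t = p²`.
  refine PadicGe.mono (PadicGe.of_pow_mul (n := 3) 2 ?_) (by norm_num)
  convert h5 using 1
  rw [centralSum]
  push_cast
  ring

end Final

theorem sum_Icc_eq_sum_range_succ (f : ℕ → ℚ) (q : ℕ) :
    ∑ k ∈ Finset.Icc 1 q, f k = ∑ k ∈ Finset.range q, f (k + 1) := by
  rw [← Finset.Ico_add_one_right_eq_Icc, Finset.sum_Ico_eq_sum_range, Nat.add_sub_cancel]
  simp only [add_comm 1]

theorem harmonicSum_eq_recipSum (n s : ℕ) : harmonicSum n s = recipSum ℚ n s := by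
  rw [harmonicSum, sum_Icc_eq_sum_range_succ, recipSum]
  push_cast
  rfl

theorem mainTheorem8 (p : ℕ) (hp : p.Prime) (hp5 : 5 < p) :
    RatModEq p
      ((∑ k ∈ Finset.Icc 1 (p - 1), 1 / ((k : ℚ) ^ 4 * (Nat.choose (2 * k) k : ℚ)))
        - 3 * ∑ k ∈ Finset.Icc 1 (p - 1),
            harmonicSum (k - 1) 2 / ((k : ℚ) ^ 2 * (Nat.choose (2 * k) k : ℚ)))
      0 := by
  have : Fact p.Prime := ⟨hp⟩
  refine ratModEq_zero_of_padicGe ?_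
  have h := padicGe_combination (p := p) (q := p - 1) (by omega) (by omega)
  rw [sum_Icc_eq_sum_range_succ, sum_Icc_eq_sum_range_succ]
  simp only [Nat.add_sub_cancel, harmonicSum_eq_recipSum, ← Nat.centralBinom_eq_two_mul_choose,
    Nat.cast_add_one]
  exact h
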